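/- Let $\mathbb T=\mathbb R/(2\pi\mathbb Z)$, let $(u,w)=\int_{\mathbb T}u(x)w(x)\,dx$ and let $\|\cdot\|$ be the norm of $L^2(\mathbb T)$ associated with it. Write $u=\sum_{k\in\mathbb Z}\hat u_k e^{ikx}$, and let $H^s(\mathbb T)$ have the norm $\|u\|_s^2=2\pi\sum_k(1+k^2)^s|\hat u_k|^2$; let $H^s_0(\mathbb T)$ be the space of real-valued $u\in H^s(\mathbb T)$ with $\hat u_0=0$. Define $\mathcal H$ and $D^s$ by $(\widehat{\mathcal H u})_k=-i\,\mathrm{sgn}(k)\hat u_k$ and $(\widehat{D^su})_k=|k|^s\hat u_k$, with $D=D^1$. Let $a\in C^\infty(\mathbb T)$ be a function with $a\ge 0$ and $\int_{\mathbb T}a(x)\,dx=1$, and set $(Gu)(x)=a(x)\big(u(x)-\int_{\mathbb T}a(y)u(y)\,dy\big)$. **Proposition 2.7.** Let $a$ be as above and let $T>0$. There is a constant $C>0$, depending only on $T$ and on the fixed function $a$, such that the following holds for all $\varepsilon>0$, $\alpha\in\mathbb R$ and $R>0$ (so $C$ is independent of $\varepsilon$, $\alpha$ and $R$). Let $v_0\in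 H^0_0(\mathbb T)$ with $\|v_0\|\le R$, and let $$v\in C([0,T];H^0_0(\mathbb T))\cap L^2(0,T;H^1(\mathbb T))\cap C((0,T];H^2(\mathbb T))$$ satisfy $$v_t+(\mathcal H-\varepsilon)v_{xx}+\alpha vv_x=-G(D(Gv))\quad\text{on }\mathbb T\times(0,T)$$ in the sense of distributions, with $v(0)=v_0$. Then $$\int_0^T\|D^{1/2}v(t)\|^2\,dt\le C\,(R^2+\alpha^4R^6).$$ -/

import Mathlib

open MeasureTheory Set Filter Topology

noncomputable section

namespace BenjaminOno

instance fact_two_pi_pos : Fact (0 < 2 * Real.pi) := ⟨Real.two_pi_pos⟩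

/-- The torus `ℝ / 2πℤ`; its `volume` is Lebesgue measure, of total mass `2π`. -/
abbrev Torus : Type := AddCircle (2 * Real.pi)

/-- `L²(𝕋)` with respect to Lebesgue measure, so that `‖u‖² = ∫_𝕋 |u(x)|² dx`. Real-valuedness of
the functions is imposed separately, in `MemH00`. -/
abbrev L2 : Type := Lp ℂ 2 (volume : Measure Torus)

/-- The exponential `x ↦ e^{ikx}` as an element of `L²(𝕋)`. -/
def expL2 (k : ℤ) : L2 :=
  ContinuousMap.toLp (E := ℂ) 2 (volume : Measure Torus) ℂ (fourier k)

/-- The Fourier multiplier `f ↦ ∑_k m(k) f̂_k e^{ikx}`, the series being summed in `L²(𝕋)`.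
Here `f̂_k = (2π)⁻¹ ∫_𝕋 f(x) e^{-ikx} dx`. It is meaningful when `∑_k |m(k) f̂_k|² < ∞`. -/
def fourierMul (m : ℤ → ℂ) (f : Torus → ℂ) : Torus → ℂ :=
  ⇑(∑' k : ℤ, (m k * fourierCoeff f k) • expL2 k)

/-- The Hilbert transform, with symbol `-i sgn(k)`. -/
def hilbert : (Torus → ℂ) → Torus → ℂ :=
  fourierMul fun k => -Complex.I * ((Int.sign k : ℤ) : ℂ)

/-- The operator `D^s`, with symbol `|k|^s`. -/
def Dpow (s : ℝ) : (Torus → ℂ) → Torus → ℂ :=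
  fourierMul fun k => (((|(k : ℝ)|) ^ s : ℝ) : ℂ)

/-- The derivative `∂ₓ`, with symbol `ik`. -/
def dx : (Torus → ℂ) → Torus → ℂ :=
  fourierMul fun k => Complex.I * (k : ℂ)

/-- The operator `(G f)(x) = a(x) (f(x) - ∫_𝕋 a(y) f(y) dy)`. -/
def opG (a : Torus → ℝ) (f : Torus → ℂ) : Torus → ℂ :=
  fun x => (a x : ℂ) * (f x - ∫ y, (a y : ℂ) * f y)

/-- Smoothness of a function on the torus: its `2π`-periodic lift to `ℝ` is `C^∞`. -/
def SmoothTorus (a : Torus → ℝ) : Prop :=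
  ContDiff ℝ (⊤ : ℕ∞) fun x : ℝ => a (x : Torus)

/-- The square of the `H^s(𝕋)` norm, `‖u‖_s² = 2π ∑_k (1 + k²)^s |û_k|²`, as an element of `[0, ∞]`;
`u ∈ H^s(𝕋)` if and only if it is finite. -/
def sobolevSq (s : ℝ) (u : L2) : ENNReal :=
  ENNReal.ofReal (2 * Real.pi) *
    ∑' k : ℤ, ENNReal.ofReal ((1 + (k : ℝ) ^ 2) ^ s * ‖fourierCoeff (⇑u) k‖ ^ 2)

/-- Membership in `H^0_0(𝕋)`: real-valued square-integrable functions of mean zero. -/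
def MemH00 (u : L2) : Prop :=
  (∀ᵐ x, (u x).im = 0) ∧ fourierCoeff (⇑u) 0 = 0

/-- Membership in `C(J; H^s(𝕋))` for a set of times `J`. -/
def ContinuousInSobolev (s : ℝ) (v : ℝ → L2) (J : Set ℝ) : Prop :=
  (∀ t ∈ J, sobolevSq s (v t) < ⊤) ∧
    ∀ t₀ ∈ J, Tendsto (fun t => sobolevSq s (v t - v t₀)) (𝓝[J] t₀) (𝓝 0)

/-- The regularity class
`C([0,T]; H^0_0(𝕋)) ∩ L²(0,T; H^1(𝕋)) ∩ C((0,T]; H^2(𝕋))`. -/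
structure Regular (T : ℝ) (v : ℝ → L2) : Prop where
  memH00 : ∀ t ∈ Icc 0 T, MemH00 (v t)
  continuousOn : ContinuousOn v (Icc 0 T)
  sqIntegrable : ∫⁻ t in Ioo 0 T, sobolevSq 1 (v t) < ⊤
  continuousH2 : ContinuousInSobolev 2 v (Ioc 0 T)

/-- Test functions on `(0,T) × 𝕋`: real-valued, `C^∞`, with compact support. -/
structure IsTestFunction (T : ℝ) (φ : ℝ → Torus → ℝ) : Prop where
  smooth : ContDiff ℝ (⊤ : ℕ∞) fun p : ℝ × ℝ => φ p.1 (p.2 : Torus)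
  support : ∃ t₀ t₁ : ℝ, 0 < t₀ ∧ t₁ < T ∧ ∀ t ∉ Icc t₀ t₁, ∀ x, φ t x = 0

/-- The equation `v_t + (H - ε) v_xx + α v v_x = -G(D(G v))` on `𝕋 × (0,T)`, in the sense of
distributions in time and space: only the time derivative is moved to the test function, as the
functions that are considered have `v(t) ∈ H²(𝕋)` for `t ∈ (0,T)`. -/
def SolvesDampedBO (a : Torus → ℝ) (ε α T : ℝ) (v : ℝ → L2) : Prop :=
  ∀ φ : ℝ → Torus → ℝ, IsTestFunction T φ →
    (∫ t in Ioo 0 T, ∫ x : Torus,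
        (-(v t x) * ((deriv (fun s => φ s x) t : ℝ) : ℂ)
          + (hilbert (dx (dx (v t))) x - (ε : ℂ) * dx (dx (v t)) x
              + (α : ℂ) * (v t x * dx (v t) x)) * (φ t x : ℂ)))
      = ∫ t in Ioo 0 T, ∫ x : Torus, -(opG a (Dpow 1 (opG a (v t))) x) * (φ t x : ℂ)

end BenjaminOno

end

open MeasureTheory Set Filter Topology ComplexConjugate

noncomputable section

namespace BenjaminOno

/-! The proof is the multiplier method for local smoothing. Let `κ = 1/(2π)` be the mean of `a` and
let `B` be a periodic primitive of `a - κ`. The equation is paired with `Bv`, and `M` times its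
pairing with `v` is added.

Pairing with `v` gives the energy identity `IsH2.re_inner_timeDeriv`: the dispersive and nonlinear
terms drop out, and what remains is the dissipation `-ε‖v_x‖² - ‖D^{1/2}Gv‖²`. Hence `‖v(t)‖ ≤ R`,
and the dissipation is available to absorb errors.

Pairing with `Bv` and integrating by parts turns the dispersive term into `((a - κ)v, Dv) + (Bv_x,
Hv_x)`. The part with `κ` is `-κ‖D^{1/2}v‖²`, the gain sought. The part with `a` is `(Gv, Dv)` plus
a mean term, hence at most `‖D^{1/2}Gv‖ ‖D^{1/2}v‖` up to lower order. Since `H` is skew-adjoint,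
the real part of `(Bv_x, Hv_x)` is half that of `(v_x, [B,H]v_x)`, and the commutator is smoothing
enough to bound this by `‖v‖²` (`FastDecay.abs_re_inner_hilbL2_le`). The nonlinear term is
`-(α/3)∫B'v³` in size; an `H^{3/8}` estimate and interpolation between `L²` and `H^{1/2}` bound it
by `(κ/4)‖D^{1/2}v‖² + Kα⁴R⁶`. The viscous and damping terms are absorbed by the dissipation once
`M` is large. All this is collected in `exists_smoothing_le`, with constants that do not see `ε`,
`α` or `R`.

Estimates involving smooth coefficients are checked on exponentials, where multiplication is a shift
of frequencies, and then summed over Fourier series (`FastDecay.norm_apply_le`).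

To use these pairings, the distributional equation has to be made classical: `(1 - ∂²)v` is
continuous in `L²` on `(0,T]`, so the prescribed time derivative is continuous in `L²` and `v` is
differentiable there (`hasDerivAt_trajectory`). Integration over compact subintervals of `(0,T)` and
exhaustion finish the proof. -/

/-! ### Fourier series in `L²(𝕋)`. -/

/-- The inclusion of continuous functions in `L²(𝕋)`. -/
def toL2 : C(Torus, ℂ) →L[ℂ] L2 := ContinuousMap.toLp 2 volume ℂ

lemma expL2_eq_toL2 (k : ℤ) : expL2 k = toL2 (fourier k) := rfl

lemma coeFn_toL2 (g : C(Torus, ℂ)) : toL2 g =ᵐ[volume] g := ContinuousMap.coeFn_toLp _ _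

lemma toL2_injective : Function.Injective toL2 := ContinuousMap.toLp_injective volume

lemma inner_toL2 (g : C(Torus, ℂ)) (f : L2) :
    inner ℂ (toL2 g) f = ∫ x, conj (g x) * f x := by
  rw [L2.inner_def]
  refine integral_congr_ae ?_
  filter_upwards [coeFn_toL2 g] with x hx
  rw [hx, RCLike.inner_apply, mul_comm]

lemma inner_toL2_toL2 (g f : C(Torus, ℂ)) :
    inner ℂ (toL2 g) (toL2 f) = ∫ x, conj (g x) * f x := by
  rw [inner_toL2]
  refine integral_congr_ae ?_
  filter_upwards [coeFn_toL2 f] with x hx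
  rw [hx]

lemma fourierCoeff_eq_integral (f : Torus → ℂ) (k : ℤ) :
    fourierCoeff f k = ((2 * Real.pi : ℝ) : ℂ)⁻¹ * ∫ x, fourier (-k) x * f x := by
  rw [fourierCoeff, AddCircle.integral_haarAddCircle, Complex.real_smul]
  simp

lemma two_pi_ne_zero' : ((2 * Real.pi : ℝ) : ℂ) ≠ 0 := by
  exact_mod_cast Real.two_pi_pos.ne'

/-- The `k`-th Fourier coefficient as a continuous linear form on `L²(𝕋)`. -/
def coef (k : ℤ) : L2 →L[ℂ] ℂ := ((2 * Real.pi : ℝ) : ℂ)⁻¹ • innerSL ℂ (expL2 k)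

lemma coef_apply (k : ℤ) (f : L2) :
    coef k f = ((2 * Real.pi : ℝ) : ℂ)⁻¹ * inner ℂ (expL2 k) f := rfl

lemma inner_expL2 (k : ℤ) (f : L2) :
    inner ℂ (expL2 k) f = ((2 * Real.pi : ℝ) : ℂ) * coef k f := by
  rw [coef_apply, mul_inv_cancel_left₀ two_pi_ne_zero']

lemma coef_eq_fourierCoeff (k : ℤ) (f : L2) : coef k f = fourierCoeff f k := by
  rw [coef_apply, expL2_eq_toL2, inner_toL2, fourierCoeff_eq_integral]
  simp

lemma fourierCoeff_congr_volume {f g : Torus → ℂ} (h : f =ᵐ[volume] g) (k : ℤ) :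
    fourierCoeff f k = fourierCoeff g k := by
  rw [fourierCoeff_eq_integral, fourierCoeff_eq_integral]
  congr 1
  refine integral_congr_ae ?_
  filter_upwards [h] with x hx
  rw [hx]

lemma coef_toL2 (k : ℤ) (g : C(Torus, ℂ)) : coef k (toL2 g) = fourierCoeff g k := by
  rw [coef_eq_fourierCoeff, fourierCoeff_congr_volume (coeFn_toL2 g)]

lemma coef_expL2 (k l : ℤ) : coef k (expL2 l) = if k = l then 1 else 0 := by
  rw [expL2_eq_toL2, coef_toL2, fourierCoeff_fourier]
  simp [Pi.single_apply]

lemma orthonormal_exp :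
    Orthonormal ℂ (fun k : ℤ => ((Real.sqrt (2 * Real.pi) : ℝ) : ℂ)⁻¹ • expL2 k) := by
  rw [orthonormal_iff_ite]
  intro k l
  have h : ((Real.sqrt (2 * Real.pi) : ℝ) : ℂ) * ((Real.sqrt (2 * Real.pi) : ℝ) : ℂ)
      = ((2 * Real.pi : ℝ) : ℂ) := by
    rw [← Complex.ofReal_mul, Real.mul_self_sqrt Real.two_pi_pos.le]
  have h0 : ((Real.sqrt (2 * Real.pi) : ℝ) : ℂ) ≠ 0 := by
    exact_mod_cast (Real.sqrt_pos.2 Real.two_pi_pos).ne'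
  rw [inner_smul_left, inner_smul_right, inner_expL2, coef_expL2, ← h, map_inv₀, Complex.conj_ofReal]
  split_ifs <;> field_simp

/-- Trigonometric polynomials are uniformly dense in `C(𝕋)`, which is dense in `L²(𝕋)`. -/
lemma span_exp_dense :
    ⊤ ≤ (Submodule.span ℂ (Set.range
      (fun k : ℤ => ((Real.sqrt (2 * Real.pi) : ℝ) : ℂ)⁻¹ • expL2 k))).topologicalClosure := by
  have h0 : ((Real.sqrt (2 * Real.pi) : ℝ) : ℂ)⁻¹ ≠ 0 :=
    inv_ne_zero (by exact_mod_cast (Real.sqrt_pos.2 Real.two_pi_pos).ne')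
  set S := Submodule.span ℂ (Set.range
      (fun k : ℤ => ((Real.sqrt (2 * Real.pi) : ℝ) : ℂ)⁻¹ • expL2 k)) with hS
  have h1 : (⊤ : Submodule ℂ C(Torus, ℂ)) ≤ S.topologicalClosure.comap toL2.toLinearMap := by
    rw [← span_fourier_closure_eq_top]
    refine Submodule.topologicalClosure_minimal _ ?_ ?_
    · rw [Submodule.span_le]
      rintro _ ⟨k, rfl⟩
      refine S.le_topologicalClosure ?_
      have : expL2 k ∈ S := by
        have := S.smul_mem (((Real.sqrt (2 * Real.pi) : ℝ) : ℂ)⁻¹⁻¹)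
          (Submodule.subset_span (s := Set.range
      (fun k : ℤ => ((Real.sqrt (2 * Real.pi) : ℝ) : ℂ)⁻¹ • expL2 k)) ⟨k, rfl⟩)
        rwa [smul_smul, inv_mul_cancel₀ h0, one_smul] at this
      exact this
    · exact S.isClosed_topologicalClosure.preimage toL2.continuous
  have h2 : DenseRange toL2 := ContinuousMap.toLp_denseRange ℂ volume ℂ (by norm_num)
  intro f _
  refine S.isClosed_topologicalClosure.closure_subset_iff.2 ?_ (h2 f)
  rintro _ ⟨g, rfl⟩
  exact h1 (Submodule.mem_top (x := g))

/-- The orthonormal basis of `L²(𝕋)` of normalized exponentials. -/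
def expBasis : HilbertBasis ℤ ℂ L2 := HilbertBasis.mk orthonormal_exp span_exp_dense

lemma expBasis_apply (k : ℤ) :
    expBasis k = ((Real.sqrt (2 * Real.pi) : ℝ) : ℂ)⁻¹ • expL2 k := by
  rw [expBasis, HilbertBasis.coe_mk]

lemma inv_sqrt_mul_inv_sqrt :
    ((Real.sqrt (2 * Real.pi) : ℝ) : ℂ)⁻¹ * ((Real.sqrt (2 * Real.pi) : ℝ) : ℂ)⁻¹ =
      ((2 * Real.pi : ℝ) : ℂ)⁻¹ := by
  rw [← mul_inv, ← Complex.ofReal_mul, Real.mul_self_sqrt Real.two_pi_pos.le]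

lemma inner_expBasis (k : ℤ) (f : L2) :
    inner ℂ (expBasis k) f = ((Real.sqrt (2 * Real.pi) : ℝ) : ℂ) * coef k f := by
  have h0 : ((Real.sqrt (2 * Real.pi) : ℝ) : ℂ) ≠ 0 := by
    exact_mod_cast (Real.sqrt_pos.2 Real.two_pi_pos).ne'
  rw [expBasis_apply, inner_smul_left, map_inv₀, Complex.conj_ofReal, coef_apply,
    ← inv_sqrt_mul_inv_sqrt]
  field_simp

/-- Parseval's identity. -/
lemma hasSum_conj_coef_mul_coef (f g : L2) :
    HasSum (fun k => conj (coef k f) * coef k g)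
      (((2 * Real.pi : ℝ) : ℂ)⁻¹ * inner ℂ f g) := by
  have h := (expBasis.hasSum_inner_mul_inner f g).mul_left (((2 * Real.pi : ℝ) : ℂ)⁻¹)
  convert! h using 1
  ext k
  have hc : inner ℂ f (expBasis k) = conj (inner ℂ (expBasis k) f) := (inner_conj_symm _ _).symm
  have hr : ((Real.sqrt (2 * Real.pi) : ℝ) : ℂ) ≠ 0 := by
    exact_mod_cast (Real.sqrt_pos.2 Real.two_pi_pos).ne'
  rw [hc, inner_expBasis, inner_expBasis, map_mul, Complex.conj_ofReal, ← inv_sqrt_mul_inv_sqrt]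
  field_simp

lemma hasSum_coef_smul_expL2 (f : L2) : HasSum (fun k => coef k f • expL2 k) f := by
  have h := expBasis.hasSum_repr f
  convert! h using 1
  ext1 k
  rw [HilbertBasis.repr_apply_apply, inner_expBasis, expBasis_apply, smul_smul]
  have h0 : ((Real.sqrt (2 * Real.pi) : ℝ) : ℂ) ≠ 0 := by
    exact_mod_cast (Real.sqrt_pos.2 Real.two_pi_pos).ne'
  congr 1
  field_simp

lemma ext_coef {f g : L2} (h : ∀ k, coef k f = coef k g) : f = g := by
  have hf := hasSum_coef_smul_expL2 f
  simp_rw [h] at hf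
  exact hf.unique (hasSum_coef_smul_expL2 g)

lemma summable_sq_coef (f : L2) : Summable fun k => ‖coef k f‖ ^ 2 := by
  have h := (hasSum_conj_coef_mul_coef f f).summable.norm
  refine h.congr fun k => ?_
  rw [norm_mul, RCLike.norm_conj, sq]

lemma hasSum_sq_coef (f : L2) :
    HasSum (fun k => ‖coef k f‖ ^ 2) ((2 * Real.pi)⁻¹ * ‖f‖ ^ 2) := by
  have h := Complex.hasSum_re (hasSum_conj_coef_mul_coef f f)
  convert! h using 1
  · ext k
    rw [← Complex.normSq_eq_conj_mul_self, Complex.ofReal_re, Complex.normSq_eq_norm_sq]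
  · rw [inner_self_eq_norm_sq_to_K, ← Complex.ofReal_inv, Complex.re_ofReal_mul]
    norm_cast

lemma exists_coef_eq {c : ℤ → ℂ} (hc : Summable fun k => ‖c k‖ ^ 2) :
    ∃ u : L2, ∀ k, coef k u = c k := by
  have hm : Memℓp (fun k => ((Real.sqrt (2 * Real.pi) : ℝ) : ℂ) * c k) 2 := by
    rw [memℓp_gen_iff (by norm_num)]
    simp only [ENNReal.toReal_ofNat, Real.rpow_ofNat, norm_mul, mul_pow]
    exact hc.mul_left _
  refine ⟨expBasis.repr.symm ⟨_, hm⟩, fun k => ?_⟩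
  have h0 : ((Real.sqrt (2 * Real.pi) : ℝ) : ℂ) ≠ 0 := by
    exact_mod_cast (Real.sqrt_pos.2 Real.two_pi_pos).ne'
  have := expBasis.repr_apply_apply (expBasis.repr.symm ⟨_, hm⟩) k
  rw [LinearIsometryEquiv.apply_symm_apply, inner_expBasis] at this
  exact (mul_left_cancel₀ h0 this).symm

/-! ### Fourier multipliers and multiplication operators. -/

/-- The bridge from the `tsum` in `fourierMul`, whose value is junk when the series diverges, to
honest elements of `L²`: exhibiting `u` with the right coefficients proves convergence as well. -/
lemma fourierMul_eq {m : ℤ → ℂ} {f : Torus → ℂ} {u : L2}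
    (h : ∀ k, m k * fourierCoeff f k = coef k u) : fourierMul m f = u := by
  simp_rw [fourierMul, h, (hasSum_coef_smul_expL2 u).tsum_eq]

lemma exists_multiplier (m : ℤ → ℂ) (C : ℝ) (hm : ∀ k, ‖m k‖ ≤ C) :
    ∃ M : L2 →L[ℂ] L2, ∀ f k, coef k (M f) = m k * coef k f := by
  have hC : 0 ≤ C := (norm_nonneg _).trans (hm 0)
  have hle : ∀ (f : L2) k, ‖m k * coef k f‖ ^ 2 ≤ C ^ 2 * ‖coef k f‖ ^ 2 := fun f k => by
    rw [norm_mul, mul_pow]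
    gcongr
    exact hm k
  have hs : ∀ f : L2, Summable fun k => ‖m k * coef k f‖ ^ 2 := fun f =>
    Summable.of_nonneg_of_le (fun _ => by positivity) (hle f) ((summable_sq_coef f).mul_left _)
  choose M hM using fun f => exists_coef_eq (hs f)
  let ML : L2 →ₗ[ℂ] L2 :=
    { toFun := M
      map_add' := fun f g => ext_coef fun k => by simp only [hM, map_add]; ring
      map_smul' := fun c f => ext_coef fun k => by
        simp only [hM, map_smul, RingHom.id_apply, smul_eq_mul]; ring }
  refine ⟨ML.mkContinuous C fun f => ?_, fun f k => hM f k⟩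
  have h1 := hasSum_sq_coef (M f)
  simp_rw [hM] at h1
  have h2 := hasSum_le (hle f) h1 ((hasSum_sq_coef f).mul_left _)
  have h3 : ‖M f‖ ^ 2 ≤ (C * ‖f‖) ^ 2 := by
    have := Real.two_pi_pos
    rw [mul_pow]
    rw [← mul_assoc, mul_comm (C ^ 2), mul_assoc] at h2
    exact le_of_mul_le_mul_left h2 (by positivity)
  exact abs_le_of_sq_le_sq' h3 (by positivity) |>.2

/-- The Fourier multiplier with a bounded symbol `m`, as a continuous operator. -/
def multiplier (m : ℤ → ℂ) (C : ℝ) (hm : ∀ k, ‖m k‖ ≤ C) : L2 →L[ℂ] L2 :=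
  (exists_multiplier m C hm).choose

@[simp]
lemma coef_multiplier {m : ℤ → ℂ} {C : ℝ} {hm : ∀ k, ‖m k‖ ≤ C} (f : L2) (k : ℤ) :
    coef k (multiplier m C hm f) = m k * coef k f :=
  (exists_multiplier m C hm).choose_spec f k

/-- Multiplication of square-integrable functions by continuous functions. -/
def mulL2 : C(Torus, ℂ) →L[ℂ] L2 →L[ℂ] L2 :=
  ((ContinuousLinearMap.mul ℂ ℂ).holderL (volume : Measure Torus) ⊤ 2 2).comp
    (ContinuousMap.toLp ⊤ volume ℂ)

lemma coeFn_mulL2 (g : C(Torus, ℂ)) (f : L2) :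
    mulL2 g f =ᵐ[volume] fun x => g x * f x := by
  have h1 : (ContinuousMap.toLp (E := ℂ) ⊤ (volume : Measure Torus) ℂ g) =ᵐ[volume] g :=
    ContinuousMap.coeFn_toLp _ _
  have h2 := (ContinuousLinearMap.mul ℂ ℂ).coeFn_holder (r := 2)
    (ContinuousMap.toLp (E := ℂ) ⊤ (volume : Measure Torus) ℂ g) f
  filter_upwards [h1, h2] with x hx1 hx2
  have : mulL2 g f x = (ContinuousLinearMap.mul ℂ ℂ)
    ((ContinuousMap.toLp (E := ℂ) ⊤ (volume : Measure Torus) ℂ g) x) (f x) := hx2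
  rw [this, hx1, ContinuousLinearMap.mul_apply']

lemma mulL2_toL2 (g h : C(Torus, ℂ)) : mulL2 g (toL2 h) = toL2 (g * h) := by
  refine Lp.ext ?_
  filter_upwards [coeFn_mulL2 g (toL2 h), coeFn_toL2 h, coeFn_toL2 (g * h)] with x h1 h2 h3
  rw [h1, h2, h3, ContinuousMap.mul_apply]

lemma coef_mulL2_fourier (n k : ℤ) (f : L2) :
    coef k (mulL2 (fourier n) f) = coef (k - n) f := by
  rw [coef_eq_fourierCoeff, coef_eq_fourierCoeff, fourierCoeff_congr_volume (coeFn_mulL2 _ _),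
    fourierCoeff_eq_integral, fourierCoeff_eq_integral]
  congr 2
  ext x
  rw [← mul_assoc, ← fourier_add]
  congr 3
  ring

lemma inner_mulL2_left (g : C(Torus, ℂ)) (f h : L2) :
    inner ℂ (mulL2 g f) h = inner ℂ f (mulL2 (star g) h) := by
  rw [L2.inner_def, L2.inner_def]
  refine integral_congr_ae ?_
  filter_upwards [coeFn_mulL2 g f, coeFn_mulL2 (star g) h] with x h1 h2
  rw [h1, h2, RCLike.inner_apply, RCLike.inner_apply, ContinuousMap.star_apply, map_mul]
  simp only [RCLike.star_def]
  ring

lemma summable_mul_and_tsum_mul_le {ι : Type*} {f g : ι → ℝ} (hf : ∀ i, 0 ≤ f i)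
    (hg : ∀ i, 0 ≤ g i) (hfs : Summable fun i => f i ^ 2) (hgs : Summable fun i => g i ^ 2) :
    (Summable fun i => f i * g i) ∧
      ∑' i, f i * g i ≤ Real.sqrt (∑' i, f i ^ 2) * Real.sqrt (∑' i, g i ^ 2) := by
  have := Real.summable_and_inner_le_Lp_mul_Lq_tsum_of_nonneg (p := 2) (q := 2)
    (by constructor <;> norm_num) hf hg (by simpa using hfs) (by simpa using hgs)
  simpa [Real.sqrt_eq_rpow] using this

/-- By Cauchy–Schwarz the coefficients are absolutely summable, so the series converges uniformly.
-/
lemma exists_synth (m : ℤ → ℂ) (hm : Summable fun k => ‖m k‖ ^ 2) :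
    ∃ S : L2 →L[ℂ] C(Torus, ℂ), ∀ f,
      HasSum (fun k : ℤ => (m k * coef k f) • (fourier k : C(Torus, ℂ))) (S f) := by
  have key : ∀ f : L2, Summable (fun k : ℤ => ‖(m k * coef k f) • (fourier k : C(Torus, ℂ))‖) ∧
      ∑' k : ℤ, ‖(m k * coef k f) • (fourier k : C(Torus, ℂ))‖ ≤
        Real.sqrt (∑' k, ‖m k‖ ^ 2) * Real.sqrt ((2 * Real.pi)⁻¹) * ‖f‖ := fun f => by
    have h := summable_mul_and_tsum_mul_le (fun k => norm_nonneg (m k))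
      (fun k => norm_nonneg (coef k f)) hm (summable_sq_coef f)
    simp only [norm_smul, fourier_norm, mul_one, norm_mul]
    refine ⟨h.1, h.2.trans_eq ?_⟩
    rw [(hasSum_sq_coef f).tsum_eq, Real.sqrt_mul (by positivity), Real.sqrt_sq (norm_nonneg _),
      mul_assoc]
  have hS : ∀ f, HasSum (fun k : ℤ => (m k * coef k f) • (fourier k : C(Torus, ℂ)))
      (∑' k : ℤ, (m k * coef k f) • (fourier k : C(Torus, ℂ))) := fun f =>
    (key f).1.of_norm.hasSum
  let SL : L2 →ₗ[ℂ] C(Torus, ℂ) :=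
    { toFun := fun f => ∑' k : ℤ, (m k * coef k f) • (fourier k : C(Torus, ℂ))
      map_add' := fun f g => by
        rw [← ((hS f).add (hS g)).tsum_eq]
        simp only [map_add, mul_add, add_smul]
      map_smul' := fun c f => by
        rw [RingHom.id_apply, ← ((hS f).const_smul c).tsum_eq]
        simp only [map_smul, smul_smul, smul_eq_mul]
        simp only [mul_left_comm] }
  exact ⟨SL.mkContinuous _ fun f => (norm_tsum_le_tsum_norm (key f).1).trans (key f).2, hS⟩

/-- The Fourier multiplier with square-summable symbol `m`, from `L²(𝕋)` to `C(𝕋)`. -/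
def synth (m : ℤ → ℂ) (hm : Summable fun k => ‖m k‖ ^ 2) : L2 →L[ℂ] C(Torus, ℂ) :=
  (exists_synth m hm).choose

lemma hasSum_synth {m : ℤ → ℂ} (hm : Summable fun k => ‖m k‖ ^ 2) (f : L2) :
    HasSum (fun k : ℤ => (m k * coef k f) • (fourier k : C(Torus, ℂ))) (synth m hm f) :=
  (exists_synth m hm).choose_spec f

lemma coef_of_hasSum {c : ℤ → ℂ} {g : C(Torus, ℂ)}
    (h : HasSum (fun k : ℤ => c k • (fourier k : C(Torus, ℂ))) g) (k : ℤ) :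
    coef k (toL2 g) = c k := by
  have h1 := ((coef k).comp toL2).hasSum h
  refine h1.unique ?_
  have : (fun l => ((coef k).comp toL2) (c l • (fourier l : C(Torus, ℂ))))
      = fun l => if l = k then c k else 0 := by
    ext l
    simp only [map_smul, ContinuousLinearMap.comp_apply, smul_eq_mul]
    rw [← expL2_eq_toL2, coef_expL2]
    by_cases hl : l = k
    · subst hl; simp
    · rw [if_neg hl, if_neg (Ne.symm hl), mul_zero]
  rw [this]
  exact hasSum_ite_eq k (c k)

@[simp]
lemma coef_toL2_synth {m : ℤ → ℂ} (hm : Summable fun k => ‖m k‖ ^ 2) (f : L2) (k : ℤ) :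
    coef k (toL2 (synth m hm f)) = m k * coef k f :=
  coef_of_hasSum (hasSum_synth hm f) k

/-! ### Classical derivatives on the torus. -/

/-- `f1` is the classical derivative of `f`. -/
def HasTorusDeriv (f f1 : C(Torus, ℂ)) : Prop :=
  ∀ x : ℝ, HasDerivAt (fun y : ℝ => f (y : Torus)) (f1 (x : Torus)) x

lemma HasTorusDeriv.mul {f f1 g g1 : C(Torus, ℂ)} (hf : HasTorusDeriv f f1)
    (hg : HasTorusDeriv g g1) : HasTorusDeriv (f * g) (f1 * g + f * g1) := fun x =>
  (hf x).mul (hg x)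

lemma HasTorusDeriv.sub {f f1 g g1 : C(Torus, ℂ)} (hf : HasTorusDeriv f f1)
    (hg : HasTorusDeriv g g1) : HasTorusDeriv (f - g) (f1 - g1) := fun x =>
  (hf x).sub (hg x)

lemma HasTorusDeriv.const_smul {f f1 : C(Torus, ℂ)} (hf : HasTorusDeriv f f1) (c : ℂ) :
    HasTorusDeriv (c • f) (c • f1) := fun x => (hf x).const_smul c

lemma HasTorusDeriv.star {f f1 : C(Torus, ℂ)} (hf : HasTorusDeriv f f1) :
    HasTorusDeriv (star f) (star f1) := fun x => (hf x).star

lemma HasTorusDeriv.integral_eq_zero {f f1 : C(Torus, ℂ)} (hf : HasTorusDeriv f f1) :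
    ∫ x, f1 x = 0 := by
  rw [← AddCircle.intervalIntegral_preimage (2 * Real.pi) 0 f1,
    intervalIntegral.integral_eq_sub_of_hasDerivAt (fun x _ => hf x)
      ((f1.continuous.comp (AddCircle.continuous_mk' _)).intervalIntegrable _ _)]
  have : ((0 + 2 * Real.pi : ℝ) : Torus) = ((0 : ℝ) : Torus) := by
    rw [zero_add, AddCircle.coe_period, AddCircle.coe_zero]
  rw [this, sub_self]

lemma hasTorusDeriv_fourier (k : ℤ) :
    HasTorusDeriv (fourier k) ((Complex.I * k) • (fourier k : C(Torus, ℂ))) := fun x => by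
  convert! hasDerivAt_fourier (2 * Real.pi) k x using 1
  rw [ContinuousMap.smul_apply, smul_eq_mul]
  congr 1
  have : (Real.pi : ℂ) ≠ 0 := by exact_mod_cast Real.pi_ne_zero
  push_cast
  field_simp

lemma integrable_coe (g : C(Torus, ℂ)) : Integrable (fun x => g x) volume :=
  g.continuous.integrable_of_hasCompactSupport (HasCompactSupport.of_compactSpace _)

lemma coef_toL2_eq_integral (k : ℤ) (f : C(Torus, ℂ)) :
    coef k (toL2 f) = ((2 * Real.pi : ℝ) : ℂ)⁻¹ * ∫ x, (fourier (-k) * f : C(Torus, ℂ)) x := by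
  rw [coef_toL2, fourierCoeff_eq_integral]
  rfl

lemma HasTorusDeriv.coef_eq {f f1 : C(Torus, ℂ)} (hf : HasTorusDeriv f f1) (k : ℤ) :
    coef k (toL2 f1) = Complex.I * k * coef k (toL2 f) := by
  have h := ((hasTorusDeriv_fourier (-k)).mul hf).integral_eq_zero
  have h1 : ∀ (c : ℂ) (p q : C(Torus, ℂ)), ∫ x, (c • p + q) x = c * (∫ x, p x) + ∫ x, q x := by
    intro c p q
    rw [← integral_const_mul, ← integral_add ((integrable_coe p).const_mul _) (integrable_coe q)]
    rfl
  rw [smul_mul_assoc, h1] at h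
  rw [coef_toL2_eq_integral, coef_toL2_eq_integral]
  generalize (∫ x, (fourier (-k) * f : C(Torus, ℂ)) x) = p at h ⊢
  generalize (∫ x, (fourier (-k) * f1 : C(Torus, ℂ)) x) = q at h ⊢
  rw [Int.cast_neg] at h
  linear_combination (((2 * Real.pi : ℝ) : ℂ)⁻¹) * h

/-- Termwise differentiation: Cauchy–Schwarz gives a majorant of the differentiated series that does
not depend on the point. -/
lemma hasTorusDeriv_synth {m : ℤ → ℂ} (hm : Summable fun k => ‖m k‖ ^ 2)
    (hm1 : Summable fun k : ℤ => ‖Complex.I * k * m k‖ ^ 2) (f : L2) :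
    HasTorusDeriv (synth m hm f) (synth (fun k => Complex.I * k * m k) hm1 f) := fun x => by
  have hpt : ∀ {m : ℤ → ℂ} (hm : Summable fun k => ‖m k‖ ^ 2) (x : Torus),
      HasSum (fun k : ℤ => m k * coef k f * fourier k x) (synth m hm f x) := fun {m} hm x => by
    simpa using (ContinuousMap.evalCLM ℂ x).hasSum (hasSum_synth hm f)
  have hs := (summable_mul_and_tsum_mul_le
    (fun k : ℤ => norm_nonneg (Complex.I * k * m k)) (fun k => norm_nonneg (coef k f)) hm1
    (summable_sq_coef f)).1
  have hd := hasDerivAt_tsum (g := fun (k : ℤ) (y : ℝ) => m k * coef k f * fourier k (y : Torus))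
    (g' := fun (k : ℤ) (y : ℝ) => Complex.I * k * m k * coef k f * fourier k (y : Torus))
    hs (fun k y => ?_) (fun k y => ?_) (hpt hm ((0 : ℝ) : Torus)).summable x
  · rw [(hpt hm1 x).tsum_eq] at hd
    simp_rw [(hpt hm _).tsum_eq] at hd
    exact hd
  · convert! (hasTorusDeriv_fourier k y).const_mul (m k * coef k f) using 1
    simp
    ring
  · rw [norm_mul, norm_mul (Complex.I * k * m k)]
    have : ‖fourier k (y : Torus)‖ = 1 := Circle.norm_coe _
    rw [this, mul_one]

/-! ### Smooth functions, decay of their coefficients, and the multiplier `B`. -/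

lemma summable_inv_one_add_sq : Summable fun k : ℤ => (1 + (k : ℝ) ^ 2)⁻¹ := by
  have h : Summable fun k : ℤ => 1 / (k : ℝ) ^ 2 := by
    simpa using Real.summable_one_div_int_pow (p := 2) |>.2 (by norm_num)
  refine (h.add (hasSum_ite_eq (0 : ℤ) (1 : ℝ)).summable).of_nonneg_of_le
    (fun k => by positivity) fun k => ?_
  by_cases hk : k = 0
  · simp [hk]
  · rw [if_neg hk, add_zero, one_div]
    have : (0 : ℝ) < (k : ℝ) ^ 2 := by positivity
    gcongr
    linarith

lemma SmoothTorus.continuous {g : Torus → ℝ} (hg : SmoothTorus g) : Continuous g :=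
  isQuotientMap_quotient_mk'.continuous_iff.2 (ContDiff.continuous hg)

/-- A smooth real function on the torus as a complex-valued continuous function. -/
def smoothC (g : Torus → ℝ) (hg : SmoothTorus g) : C(Torus, ℂ) :=
  ⟨fun x => (g x : ℂ), Complex.continuous_ofReal.comp hg.continuous⟩

@[simp]
lemma smoothC_apply {g : Torus → ℝ} (hg : SmoothTorus g) (x : Torus) : smoothC g hg x = g x := rfl

lemma star_smoothC {g : Torus → ℝ} (hg : SmoothTorus g) : star (smoothC g hg) = smoothC g hg := by
  ext x
  simp

lemma smoothTorus_lift {f : ℝ → ℝ} (hf : Function.Periodic f (2 * Real.pi))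
    (hs : ContDiff ℝ (⊤ : ℕ∞) f) : SmoothTorus hf.lift := by
  unfold SmoothTorus
  simpa only [Function.Periodic.lift_coe] using hs

lemma periodic_comp_coe (g : Torus → ℝ) :
    Function.Periodic (fun x : ℝ => g (x : Torus)) (2 * Real.pi) := fun x => by
  simp only [AddCircle.coe_add_period]

lemma SmoothTorus.exists_deriv {g : Torus → ℝ} (hg : SmoothTorus g) :
    ∃ (g1 : Torus → ℝ), SmoothTorus g1 ∧
      ∀ x : ℝ, HasDerivAt (fun y : ℝ => g (y : Torus)) (g1 (x : Torus)) x := by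
  have hp : Function.Periodic (deriv fun y : ℝ => g (y : Torus)) (2 * Real.pi) := fun x => by
    rw [← deriv_comp_add_const]
    congr 1
    ext y
    exact periodic_comp_coe g y
  have hd : ContDiff ℝ (⊤ : ℕ∞) (deriv fun y : ℝ => g (y : Torus)) :=
    (contDiff_infty_iff_deriv.1 hg).2
  refine ⟨hp.lift, smoothTorus_lift hp hd, fun x => ?_⟩
  rw [Function.Periodic.lift_coe]
  exact (hg.differentiable (by norm_num) x).hasDerivAt

lemma hasTorusDeriv_smoothC {g g1 : Torus → ℝ} (hg : SmoothTorus g) (hg1 : SmoothTorus g1)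
    (h : ∀ x : ℝ, HasDerivAt (fun y : ℝ => g (y : Torus)) (g1 (x : Torus)) x) :
    HasTorusDeriv (smoothC g hg) (smoothC g1 hg1) := fun x => (h x).ofReal_comp

/-- Fourier coefficients decaying fast enough for the operators of order at most two. -/
def FastDecay (g : C(Torus, ℂ)) : Prop :=
  Summable fun k : ℤ => (1 + (k : ℝ) ^ 2) * ‖coef k (toL2 g)‖

/-- The witness is `g - g''`. -/
lemma SmoothTorus.exists_coef_eq {g : Torus → ℝ} (hg : SmoothTorus g) :
    ∃ (h : Torus → ℝ) (hh : SmoothTorus h), ∀ k : ℤ,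
      coef k (toL2 (smoothC h hh)) = (1 + (k : ℂ) ^ 2) * coef k (toL2 (smoothC g hg)) := by
  obtain ⟨g1, hg1, hd1⟩ := hg.exists_deriv
  obtain ⟨g2, hg2, hd2⟩ := hg1.exists_deriv
  have hs : SmoothTorus (fun x => g x - g2 x) := ContDiff.sub hg hg2
  refine ⟨_, hs, fun k => ?_⟩
  have h1 := (hasTorusDeriv_smoothC hg hg1 hd1).coef_eq k
  have h2 := (hasTorusDeriv_smoothC hg1 hg2 hd2).coef_eq k
  have h3 : smoothC _ hs = smoothC g hg - smoothC g2 hg2 := by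
    ext x
    simp
  rw [h3, map_sub, map_sub, h2, h1]
  linear_combination (-(k : ℂ) ^ 2 * coef k (toL2 (smoothC g hg))) * Complex.I_sq

lemma sq_norm_coef_le (k : ℤ) (f : L2) : ‖coef k f‖ ^ 2 ≤ ‖f‖ ^ 2 := by
  have h := le_hasSum (hasSum_sq_coef f) k fun _ _ => by positivity
  refine h.trans ?_
  have : (2 * Real.pi)⁻¹ ≤ 1 := inv_le_one_of_one_le₀ (by nlinarith [Real.pi_gt_three])
  exact mul_le_of_le_one_left (by positivity) this

/-- Applying `1 - ∂²` twice bounds the coefficients by a multiple of `(1 + k²)⁻²`; the weight `1 +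
k²` in `FastDecay` then leaves the summable `(1 + k²)⁻¹`. -/
lemma fastDecay_smoothC {g : Torus → ℝ} (hg : SmoothTorus g) : FastDecay (smoothC g hg) := by
  obtain ⟨g1, hg1, h1⟩ := hg.exists_coef_eq
  obtain ⟨g2, hg2, h2⟩ := hg1.exists_coef_eq
  refine (summable_inv_one_add_sq.mul_right ‖toL2 (smoothC g2 hg2)‖).of_nonneg_of_le
    (fun k => by positivity) fun k => ?_
  have hb := abs_le_of_sq_le_sq' (sq_norm_coef_le k (toL2 (smoothC g2 hg2))) (norm_nonneg _) |>.2
  have hn : ‖(1 + (k : ℂ) ^ 2)‖ = 1 + (k : ℝ) ^ 2 := by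
    have : (1 + (k : ℂ) ^ 2) = ((1 + (k : ℝ) ^ 2 : ℝ) : ℂ) := by push_cast; rfl
    rw [this, Complex.norm_real, Real.norm_of_nonneg (by positivity)]
  rw [h2, h1, norm_mul, norm_mul, hn] at hb
  rw [inv_mul_eq_div, le_div_iff₀ (by positivity), mul_comm]
  exact hb

lemma FastDecay.summable {g : C(Torus, ℂ)} (hg : FastDecay g) :
    Summable fun k => ‖coef k (toL2 g)‖ :=
  Summable.of_nonneg_of_le (fun _ => norm_nonneg _)
    (fun k => le_mul_of_one_le_left (norm_nonneg _) (by nlinarith [sq_nonneg (k : ℝ)])) hg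

lemma FastDecay.hasSum {g : C(Torus, ℂ)} (hg : FastDecay g) :
    HasSum (fun k : ℤ => coef k (toL2 g) • (fourier k : C(Torus, ℂ))) g := by
  have h := hasSum_fourier_series_of_summable (f := g) (by
    refine Summable.of_norm ?_
    simpa only [coef_toL2] using hg.summable)
  simpa only [coef_toL2] using h

/-- A form that is bounded on the exponentials, with quadratic growth in the frequency, is bounded
on functions with fast decay of the Fourier coefficients. -/
lemma FastDecay.norm_apply_le {E : Type*} [NormedAddCommGroup E] [NormedSpace ℂ E]
    {g : C(Torus, ℂ)} (hg : FastDecay g) (L : C(Torus, ℂ) →L[ℂ] E) {B : ℝ}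
    (hL : ∀ n : ℤ, ‖L (fourier n)‖ ≤ (1 + (n : ℝ) ^ 2) * B) :
    ‖L g‖ ≤ (∑' n : ℤ, (1 + (n : ℝ) ^ 2) * ‖coef n (toL2 g)‖) * B := by
  have h := L.hasSum hg.hasSum
  rw [← h.tsum_eq]
  have hle : ∀ n : ℤ, ‖L (coef n (toL2 g) • fourier n)‖
      ≤ (1 + (n : ℝ) ^ 2) * ‖coef n (toL2 g)‖ * B := fun n => by
    rw [map_smul, norm_smul, mul_comm (1 + (n : ℝ) ^ 2), mul_assoc]
    gcongr
    exact hL n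
  refine (tsum_of_norm_bounded (hg.mul_right B).hasSum hle).trans_eq ?_
  rw [tsum_mul_right]

/-- The function `b` is the weight of the multiplier method. As `∫ a = 1`, subtracting the mean
`1/(2π)` makes the primitive periodic. -/
lemma exists_antideriv {a : Torus → ℝ} (ha : SmoothTorus a) (hint : ∫ x, a x = 1) :
    ∃ (b : Torus → ℝ) (hb : SmoothTorus b),
      HasTorusDeriv (smoothC b hb)
        (smoothC a ha - (((2 * Real.pi : ℝ) : ℂ)⁻¹) • (1 : C(Torus, ℂ))) := by
  set f : ℝ → ℝ := fun x => ∫ y in (0 : ℝ)..x, (a (y : Torus) - (2 * Real.pi)⁻¹) with hf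
  have hc : Continuous fun y : ℝ => a (y : Torus) - (2 * Real.pi)⁻¹ :=
    (ContDiff.continuous ha).sub continuous_const
  have hd : ∀ x : ℝ, HasDerivAt f (a (x : Torus) - (2 * Real.pi)⁻¹) x := fun x =>
    intervalIntegral.integral_hasDerivAt_right (hc.intervalIntegrable _ _)
      (hc.stronglyMeasurableAtFilter _ _) hc.continuousAt
  have hper : Function.Periodic f (2 * Real.pi) := fun x => by
    have h1 : f (x + 2 * Real.pi) = f x
        + ∫ y in x..(x + 2 * Real.pi), (a (y : Torus) - (2 * Real.pi)⁻¹) :=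
      (intervalIntegral.integral_add_adjacent_intervals (hc.intervalIntegrable _ _)
        (hc.intervalIntegrable _ _)).symm
    rw [h1, intervalIntegral.integral_sub ((ContDiff.continuous ha).intervalIntegrable _ _)
      (continuous_const.intervalIntegrable _ _),
      AddCircle.intervalIntegral_preimage (2 * Real.pi) x a, hint, intervalIntegral.integral_const]
    have := Real.pi_pos.ne'
    simp
    field_simp
    simp
  have hsm : ContDiff ℝ (⊤ : ℕ∞) f := by
    rw [contDiff_infty_iff_deriv]
    refine ⟨fun x => (hd x).differentiableAt, ?_⟩
    have : deriv f = fun x : ℝ => a (x : Torus) - (2 * Real.pi)⁻¹ := by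
      ext x
      exact (hd x).deriv
    rw [this]
    exact ContDiff.sub ha contDiff_const
  refine ⟨hper.lift, smoothTorus_lift hper hsm, fun x => ?_⟩
  have := (hd x).ofReal_comp
  convert! this using 1
  simp

/-! ### The Hilbert transform, its commutators, and the `H^{1/2}` form. -/

lemma norm_inner_le_tsum {u w : L2} {s : ℤ → ℝ} (hs : Summable s)
    (h : ∀ k, ‖coef k u‖ * ‖coef k w‖ ≤ s k) : ‖inner ℂ u w‖ ≤ 2 * Real.pi * ∑' k, s k := by
  have h1 := (hasSum_conj_coef_mul_coef u w)
  have h2 : ‖((2 * Real.pi : ℝ) : ℂ)⁻¹ * inner ℂ u w‖ ≤ ∑' k, s k := by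
    rw [← h1.tsum_eq]
    refine tsum_of_norm_bounded hs.hasSum fun k => ?_
    rw [norm_mul, RCLike.norm_conj]
    exact h k
  rw [norm_mul, norm_inv, Complex.norm_real, Real.norm_of_nonneg Real.two_pi_pos.le,
    inv_mul_le_iff₀ Real.two_pi_pos] at h2
  exact h2

lemma norm_sq_eq_tsum (f : L2) : ‖f‖ ^ 2 = 2 * Real.pi * ∑' k, ‖coef k f‖ ^ 2 := by
  rw [(hasSum_sq_coef f).tsum_eq, mul_inv_cancel_left₀ Real.two_pi_pos.ne']

/-- The homogeneous `H^{1/2}` seminorm, squared. -/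
def halfSq (f : L2) : ℝ := 2 * Real.pi * ∑' k : ℤ, |(k : ℝ)| * ‖coef k f‖ ^ 2

lemma halfSq_nonneg (f : L2) : 0 ≤ halfSq f :=
  mul_nonneg Real.two_pi_pos.le (tsum_nonneg fun _ => by positivity)

/-- The Hilbert transform on `L²(𝕋)`. -/
def hilbL2 : L2 →L[ℂ] L2 :=
  multiplier (fun k => -Complex.I * ((Int.sign k : ℤ) : ℂ)) 1 fun k => by
    rcases lt_trichotomy k 0 with h | h | h
    · simp [Int.sign_eq_neg_one_of_neg h]
    · simp [h]
    · simp [Int.sign_eq_one_of_pos h]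

@[simp]
lemma coef_hilbL2 (f : L2) (k : ℤ) :
    coef k (hilbL2 f) = -Complex.I * ((Int.sign k : ℤ) : ℂ) * coef k f := coef_multiplier f k

lemma inner_eq_inner_of_coef {u w u' w' : L2}
    (h : ∀ k, conj (coef k u) * coef k w = conj (coef k u') * coef k w') :
    inner ℂ u w = inner ℂ u' w' := by
  have h1 := hasSum_conj_coef_mul_coef u w
  simp_rw [h] at h1
  exact mul_left_cancel₀ (inv_ne_zero two_pi_ne_zero') (h1.unique (hasSum_conj_coef_mul_coef u' w'))

lemma inner_hilbL2_left (u w : L2) : inner ℂ (hilbL2 u) w = -inner ℂ u (hilbL2 w) := by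
  rw [← inner_neg_right]
  refine inner_eq_inner_of_coef fun k => ?_
  simp only [map_neg, coef_hilbL2, map_mul, Complex.conj_I, map_intCast]
  ring

/-- The left side vanishes unless `k` and `m` have strictly opposite signs; then `(k - m)² = (|k| +
|m|)² ≥ 4|k||m|`. This is why the commutator gains two derivatives: high frequencies interact only
across a gap `|k - m|` comparable to their size, which is paid by the smooth coefficient. -/
lemma abs_mul_abs_mul_abs_sign_sub_le (k m : ℤ) :
    |k| * |m| * |Int.sign m - Int.sign k| ≤ 2 * (k - m) ^ 2 := by
  rcases lt_trichotomy k 0 with hk | hk | hk <;> rcases lt_trichotomy m 0 with hm | hm | hm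
  · rw [Int.sign_eq_neg_one_of_neg hk, Int.sign_eq_neg_one_of_neg hm]; simp; positivity
  · subst hm; simp; positivity
  · rw [Int.sign_eq_neg_one_of_neg hk, Int.sign_eq_one_of_pos hm, abs_of_neg hk, abs_of_pos hm]
    norm_num; nlinarith [sq_nonneg (k + m)]
  · subst hk; simp; positivity
  · subst hk; simp; positivity
  · subst hk; simp; positivity
  · rw [Int.sign_eq_one_of_pos hk, Int.sign_eq_neg_one_of_neg hm, abs_of_neg hm, abs_of_pos hk]
    norm_num; nlinarith [sq_nonneg (k + m)]
  · subst hm; simp; positivity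
  · rw [Int.sign_eq_one_of_pos hk, Int.sign_eq_one_of_pos hm]; simp; positivity

lemma summable_shift {s : ℤ → ℝ} (hs : Summable s) (n : ℤ) : Summable fun k => s (k - n) :=
  (Equiv.subRight n).summable_iff.2 hs

lemma tsum_shift (s : ℤ → ℝ) (n : ℤ) : ∑' k, s (k - n) = ∑' k, s k :=
  (Equiv.subRight n).tsum_eq s

/-- The commutator of the Hilbert transform with a real function of fast decay gains two
derivatives. -/
lemma FastDecay.abs_re_inner_hilbL2_le {b : C(Torus, ℂ)} (hb : FastDecay b) (hbr : star b = b)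
    {f f1 : L2} (hf : ∀ k : ℤ, coef k f1 = Complex.I * k * coef k f) :
    |(inner ℂ (mulL2 b f1) (hilbL2 f1)).re|
      ≤ (∑' n : ℤ, (1 + (n : ℝ) ^ 2) * ‖coef n (toL2 b)‖) * ‖f‖ ^ 2 := by
  -- `L g` is `(f1, [g, H] f1)`, linear in `g`, so it suffices to bound it on exponentials.
  set L : C(Torus, ℂ) →L[ℂ] ℂ := (innerSL ℂ f1).comp
    (mulL2.flip (hilbL2 f1) - hilbL2.comp (mulL2.flip f1)) with hL
  have hLb : (L b).re = 2 * (inner ℂ (mulL2 b f1) (hilbL2 f1)).re := by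
    have h1 : L b = inner ℂ f1 (mulL2 b (hilbL2 f1)) - inner ℂ f1 (hilbL2 (mulL2 b f1)) := by
      rw [← inner_sub_right]; rfl
    have h2 : inner ℂ f1 (mulL2 b (hilbL2 f1)) = inner ℂ (mulL2 b f1) (hilbL2 f1) := by
      rw [inner_mulL2_left, hbr]
    have h3 : inner ℂ f1 (hilbL2 (mulL2 b f1)) = -conj (inner ℂ (mulL2 b f1) (hilbL2 f1)) := by
      rw [inner_conj_symm, inner_hilbL2_left, neg_neg]
    rw [h1, h2, h3, sub_neg_eq_add, Complex.add_re, Complex.conj_re]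
    ring
  have hbd : ∀ n : ℤ, ‖L (fourier n)‖ ≤ (1 + (n : ℝ) ^ 2) * (2 * ‖f‖ ^ 2) := fun n => by
    have h1 : L (fourier n) = inner ℂ f1
      (mulL2 (fourier n) (hilbL2 f1) - hilbL2 (mulL2 (fourier n) f1)) := rfl
    have hsum : Summable fun k => (n : ℝ) ^ 2 * (‖coef k f‖ ^ 2 + ‖coef (k - n) f‖ ^ 2) :=
      ((summable_sq_coef f).add (summable_shift (summable_sq_coef f) n)).mul_left _
    rw [h1]
    refine (norm_inner_le_tsum hsum fun k => ?_).trans ?_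
    · rw [map_sub, coef_mulL2_fourier, coef_hilbL2, coef_hilbL2, coef_mulL2_fourier, hf, hf,
        ← sub_mul, ← mul_sub]
      simp only [norm_mul, norm_neg, Complex.norm_I, one_mul]
      rw [← Int.cast_sub (k - n).sign]
      simp only [Complex.norm_intCast]
      have h := abs_mul_abs_mul_abs_sign_sub_le k (k - n)
      have h' : |(k : ℝ)| * |((k - n : ℤ) : ℝ)| * |(((k - n).sign - k.sign : ℤ) : ℝ)|
          ≤ 2 * (n : ℝ) ^ 2 := by
        rw [sub_sub_cancel] at h
        exact_mod_cast h
      calc _ = (|(k : ℝ)| * |((k - n : ℤ) : ℝ)| * |(((k - n).sign - k.sign : ℤ) : ℝ)|)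
            * (‖coef k f‖ * ‖coef (k - n) f‖) := by ring
        _ ≤ (2 * (n : ℝ) ^ 2) * (‖coef k f‖ * ‖coef (k - n) f‖) := by gcongr
        _ ≤ _ := by nlinarith [sq_nonneg (‖coef k f‖ - ‖coef (k - n) f‖), sq_nonneg (n : ℝ),
                      mul_nonneg (sq_nonneg (n : ℝ))
                        (sq_nonneg (‖coef k f‖ - ‖coef (k - n) f‖))]
    · rw [tsum_mul_left, (summable_sq_coef f).tsum_add (summable_shift (summable_sq_coef f) n),
        tsum_shift (fun k => ‖coef k f‖ ^ 2) n, norm_sq_eq_tsum f]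
      have : 0 ≤ ∑' k, ‖coef k f‖ ^ 2 := tsum_nonneg fun _ => by positivity
      nlinarith [Real.two_pi_pos, mul_nonneg Real.two_pi_pos.le this]
  have h := (Complex.abs_re_le_norm _).trans (hb.norm_apply_le L hbd)
  rw [hLb, abs_mul, abs_two] at h
  linarith

lemma summable_abs_mul_sq_coef {f Df : L2} (hf : ∀ k : ℤ, coef k Df = |(k : ℝ)| * coef k f) :
    Summable fun k : ℤ => |(k : ℝ)| * ‖coef k f‖ ^ 2 := by
  refine ((summable_sq_coef Df).add (summable_sq_coef f)).of_nonneg_of_le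
    (fun k => by positivity) fun k => ?_
  rw [hf, norm_mul, Complex.norm_real, Real.norm_eq_abs, abs_abs, mul_pow]
  nlinarith [sq_nonneg (|(k : ℝ)| - 1), sq_nonneg ‖coef k f‖,
    mul_nonneg (sq_nonneg (|(k : ℝ)| - 1)) (sq_nonneg ‖coef k f‖),
    mul_nonneg (sq_nonneg (|(k : ℝ)|)) (sq_nonneg ‖coef k f‖)]

/-- Here, as below, `D f` enters as a given element of `L²` with the right coefficients, so that no
unbounded operator is needed. -/
lemma inner_eq_halfSq {f Df : L2} (hf : ∀ k : ℤ, coef k Df = |(k : ℝ)| * coef k f) :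
    inner ℂ f Df = halfSq f := by
  have h := hasSum_conj_coef_mul_coef f Df
  have h2 : HasSum (fun k : ℤ => conj (coef k f) * coef k Df)
      ((∑' k : ℤ, |(k : ℝ)| * ‖coef k f‖ ^ 2 : ℝ) : ℂ) := by
    convert! Complex.hasSum_ofReal.2 (summable_abs_mul_sq_coef hf).hasSum using 1
    ext k
    rw [hf, mul_left_comm, ← Complex.normSq_eq_conj_mul_self, Complex.normSq_eq_norm_sq]
    push_cast
    rfl
  have h3 := h.unique h2
  rw [inv_mul_eq_iff_eq_mul₀ two_pi_ne_zero'] at h3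
  rw [h3, halfSq, ← Complex.ofReal_mul]

/-- Multiplication by a function of fast decay is bounded for the `H^{1/2}` form. -/
lemma FastDecay.norm_inner_mulL2_le {g : C(Torus, ℂ)} (hg : FastDecay g) {u f Df : L2}
    (hu : Summable fun k : ℤ => |(k : ℝ)| * ‖coef k u‖ ^ 2)
    (hf : ∀ k : ℤ, coef k Df = |(k : ℝ)| * coef k f) :
    ‖inner ℂ Df (mulL2 g u)‖ ≤ (∑' n : ℤ, (1 + (n : ℝ) ^ 2) * ‖coef n (toL2 g)‖)
      * (Real.sqrt (halfSq f) * Real.sqrt (halfSq u + ‖u‖ ^ 2)) := by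
  refine hg.norm_apply_le ((innerSL ℂ Df).comp (mulL2.flip u)) fun n => ?_
  have h1 : ((innerSL ℂ Df).comp (mulL2.flip u)) (fourier n)
      = inner ℂ Df (mulL2 (fourier n) u) := rfl
  rw [h1]
  have hfs := summable_abs_mul_sq_coef hf
  -- After the shift by `n`, the weight `|k|` splits as `|k| ≤ |k - n| + |n|`, one half-derivative
  -- on `u` plus a loss polynomial in `n`.
  have hle : ∀ k : ℤ, |(k : ℝ)| * ‖coef (k - n) u‖ ^ 2
      ≤ |((k - n : ℤ) : ℝ)| * ‖coef (k - n) u‖ ^ 2 + |(n : ℝ)| * ‖coef (k - n) u‖ ^ 2 := fun k => by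
    rw [← add_mul]
    gcongr
    push_cast
    have := abs_add_le ((k : ℝ) - n) n
    rwa [sub_add_cancel] at this
  have hs1 := summable_shift hu n
  have hs2 := (summable_shift (summable_sq_coef u) n).mul_left |(n : ℝ)|
  have hus : Summable fun k : ℤ => |(k : ℝ)| * ‖coef (k - n) u‖ ^ 2 :=
    (hs1.add hs2).of_nonneg_of_le (fun k => by positivity) hle
  have hsq : ∀ (k : ℤ) (x : ℝ), (Real.sqrt |(k : ℝ)| * x) ^ 2 = |(k : ℝ)| * x ^ 2 := fun k x => by
    rw [mul_pow, Real.sq_sqrt (abs_nonneg _)]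
  obtain ⟨hcs1, hcs2⟩ := summable_mul_and_tsum_mul_le
    (f := fun k : ℤ => Real.sqrt |(k : ℝ)| * ‖coef k f‖)
    (g := fun k : ℤ => Real.sqrt |(k : ℝ)| * ‖coef (k - n) u‖)
    (fun k => by positivity) (fun k => by positivity)
    (by simpa only [hsq] using hfs) (by simpa only [hsq] using hus)
  simp only [hsq] at hcs2
  refine (norm_inner_le_tsum hcs1 fun k => ?_).trans ?_
  · rw [hf, coef_mulL2_fourier, norm_mul, Complex.norm_real, Real.norm_eq_abs, abs_abs]
    refine le_of_eq ?_
    linear_combination (-‖coef k f‖ * ‖coef (k - n) u‖) * Real.mul_self_sqrt (abs_nonneg (k : ℝ))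
  have hU : 2 * Real.pi * ∑' k : ℤ, |(k : ℝ)| * ‖coef (k - n) u‖ ^ 2
      ≤ (1 + (n : ℝ) ^ 2) ^ 2 * (halfSq u + ‖u‖ ^ 2) := by
    have h2 := hus.tsum_le_tsum hle (hs1.add hs2)
    rw [hs1.tsum_add hs2, tsum_mul_left, tsum_shift (fun k => ‖coef k u‖ ^ 2),
      tsum_shift (fun k : ℤ => |(k : ℝ)| * ‖coef k u‖ ^ 2)] at h2
    have h3 := mul_le_mul_of_nonneg_left h2 Real.two_pi_pos.le
    refine h3.trans ?_
    have h4 : 2 * Real.pi * (∑' k : ℤ, |(k : ℝ)| * ‖coef k u‖ ^ 2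
        + |(n : ℝ)| * ∑' k, ‖coef k u‖ ^ 2) = halfSq u + |(n : ℝ)| * ‖u‖ ^ 2 := by
      rw [norm_sq_eq_tsum, halfSq]; ring
    rw [h4, mul_add]
    have h5 : |(n : ℝ)| ≤ (1 + (n : ℝ) ^ 2) ^ 2 := by
      nlinarith [sq_nonneg (|(n : ℝ)| - 1), sq_abs (n : ℝ), sq_nonneg ((n : ℝ) ^ 2)]
    have h6 : 1 ≤ (1 + (n : ℝ) ^ 2) ^ 2 := by
      nlinarith [sq_nonneg (n : ℝ), sq_nonneg ((n : ℝ) ^ 2)]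
    have := halfSq_nonneg u
    gcongr
    exact le_mul_of_one_le_left this h6
  have h2p := Real.two_pi_pos.le
  calc 2 * Real.pi * ∑' k : ℤ, Real.sqrt |(k : ℝ)| * ‖coef k f‖ *
        (Real.sqrt |(k : ℝ)| * ‖coef (k - n) u‖)
      ≤ 2 * Real.pi * (Real.sqrt (∑' k : ℤ, |(k : ℝ)| * ‖coef k f‖ ^ 2)
        * Real.sqrt (∑' k : ℤ, |(k : ℝ)| * ‖coef (k - n) u‖ ^ 2)) := by gcongr
    _ = Real.sqrt (halfSq f)
        * Real.sqrt (2 * Real.pi * ∑' k : ℤ, |(k : ℝ)| * ‖coef (k - n) u‖ ^ 2) := by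
      rw [halfSq, Real.sqrt_mul h2p, Real.sqrt_mul h2p]
      linear_combination (-(Real.sqrt (∑' k : ℤ, |(k : ℝ)| * ‖coef k f‖ ^ 2)
        * Real.sqrt (∑' k : ℤ, |(k : ℝ)| * ‖coef (k - n) u‖ ^ 2))) * Real.mul_self_sqrt h2p
    _ ≤ Real.sqrt (halfSq f) * Real.sqrt ((1 + (n : ℝ) ^ 2) ^ 2 * (halfSq u + ‖u‖ ^ 2)) := by
      gcongr
    _ = _ := by
      rw [Real.sqrt_mul (by positivity), Real.sqrt_sq (by positivity)]
      ring

/-! ### The trilinear estimate for the nonlinearity. -/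

/-- With `x = y⁴` the left side is `y³`, bounded by `t y⁴` if `ty ≥ 1` and by `t⁻³` otherwise. The
free parameter `t` is later tuned to `|α|R`. -/
lemma rpow_three_quarters_le {x t : ℝ} (hx : 0 ≤ x) (ht : 0 < t) :
    x ^ (3 / 4 : ℝ) ≤ t * x + (t ^ 3)⁻¹ := by
  obtain ⟨y, hy, rfl⟩ : ∃ y : ℝ, 0 ≤ y ∧ x = y ^ 4 :=
    ⟨x ^ (1 / 4 : ℝ), by positivity, by
      rw [← Real.rpow_natCast, ← Real.rpow_mul hx]; norm_num⟩
  have h1 : (y ^ 4) ^ (3 / 4 : ℝ) = y ^ 3 := by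
    rw [← Real.rpow_natCast, ← Real.rpow_mul hy, ← Real.rpow_natCast]; norm_num
  rw [h1]
  rcases le_total 1 (t * y) with h | h
  · have : 0 ≤ (t ^ 3)⁻¹ := by positivity
    nlinarith [mul_le_mul_of_nonneg_left h (pow_nonneg hy 3)]
  · have h2 : y ^ 3 ≤ (t ^ 3)⁻¹ := by
      rw [← inv_pow]
      gcongr
      rw [← one_div, le_div_iff₀ ht]
      linarith
    have : 0 ≤ t * y ^ 4 := by positivity
    linarith

/-- The weight `(1 + |k|)^{3/8}`. -/
def wt (k : ℤ) : ℝ := (1 + |(k : ℝ)|) ^ (3 / 8 : ℝ)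

lemma wt_pos (k : ℤ) : 0 < wt k := Real.rpow_pos_of_pos (by positivity) _

lemma wt_sq (k : ℤ) : wt k ^ 2 = (1 + |(k : ℝ)|) ^ (3 / 4 : ℝ) := by
  rw [wt, ← Real.rpow_natCast, ← Real.rpow_mul (by positivity)]; norm_num

/-- An order above `1/4` is needed, at which `H^s` reaches `L⁴`: at `1/4` itself this series would
be harmonic. The choice `3/8` makes interpolation cost `t⁻³`, which produces `α⁴R⁶`. -/
lemma summable_inv_wt_pow_four : Summable fun k : ℤ => ((wt k) ^ 4)⁻¹ := by
  have h1 : ∀ k : ℤ, ((wt k) ^ 4)⁻¹ = (1 + |(k : ℝ)|) ^ (-(3 / 2) : ℝ) := fun k => by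
    rw [wt, Real.rpow_neg (by positivity), ← Real.rpow_natCast, ← Real.rpow_mul (by positivity)]
    norm_num
  simp_rw [h1]
  have h : Summable fun k : ℤ => |(k : ℝ)| ^ (-(3 / 2) : ℝ) :=
    Real.summable_abs_int_rpow (by norm_num)
  refine (h.add (hasSum_ite_eq (0 : ℤ) (1 : ℝ)).summable).of_nonneg_of_le
    (fun k => by positivity) fun k => ?_
  by_cases hk : k = 0
  · subst hk
    have : (0 : ℝ) ≤ |((0 : ℤ) : ℝ)| ^ (-(3 / 2) : ℝ) := by positivity
    simp
  · rw [if_neg hk, add_zero]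
    exact Real.rpow_le_rpow_of_nonpos (by positivity) (by linarith) (by norm_num)

/-- The map `(n, k) ↦ (n, k - n)`. -/
def shiftEquiv : ℤ × ℤ ≃ ℤ × ℤ where
  toFun p := (p.1, p.2 - p.1)
  invFun p := (p.1, p.2 + p.1)
  left_inv p := by simp
  right_inv p := by simp

/-- The map `(n, k) ↦ (k - n, k)`. -/
def reflectEquiv : ℤ × ℤ ≃ ℤ × ℤ where
  toFun p := (p.2 - p.1, p.2)
  invFun p := (p.2 - p.1, p.2)
  left_inv p := by simp
  right_inv p := by simp

lemma hasSum_mul_prod {f g : ℤ → ℝ} {s t : ℝ} (hf : ∀ k, 0 ≤ f k) (hg : ∀ k, 0 ≤ g k)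
    (hfs : HasSum f s) (hgs : HasSum g t) :
    HasSum (fun q : ℤ × ℤ => f q.1 * g q.2) (s * t) :=
  hfs.mul hgs (hfs.summable.mul_of_nonneg hgs.summable hf hg)

/-- A trilinear convolution estimate. -/
lemma tsum_conv_le {c p : ℤ → ℝ} (hc : ∀ k, 0 ≤ c k) (hp : ∀ k, 0 ≤ p k)
    (hcs : Summable fun k => wt k ^ 2 * c k ^ 2) (hps : Summable fun k => p k ^ 2) :
    (Summable fun q : ℤ × ℤ => c q.1 * (p q.2 * c (q.2 - q.1))) ∧
      ∑' q : ℤ × ℤ, c q.1 * (p q.2 * c (q.2 - q.1)) ≤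
        Real.sqrt (∑' k, ((wt k) ^ 4)⁻¹) * Real.sqrt (∑' k, p k ^ 2)
          * ∑' k, wt k ^ 2 * c k ^ 2 := by
  obtain ⟨W, hW⟩ := hcs
  obtain ⟨P, hP⟩ := hps
  obtain ⟨S, hS⟩ := summable_inv_wt_pow_four
  rw [hW.tsum_eq, hP.tsum_eq, hS.tsum_eq]
  have hW0 : 0 ≤ W := hW.nonneg fun k => by positivity
  have hS0 : 0 ≤ S := hS.nonneg fun k => by have := wt_pos k; positivity
  -- Cauchy–Schwarz on `ℤ × ℤ`: both copies of `c` with their weights go into `x`, and `p` with the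
  -- inverse weights into `y`.
  obtain ⟨x, hxd⟩ : ∃ x : ℤ × ℤ → ℝ,
      ∀ q, x q = (wt q.1 * wt (q.2 - q.1)) * (c q.1 * c (q.2 - q.1)) := ⟨_, fun _ => rfl⟩
  obtain ⟨y, hyd⟩ : ∃ y : ℤ × ℤ → ℝ, ∀ q, y q = p q.2 * (wt q.1 * wt (q.2 - q.1))⁻¹ :=
    ⟨_, fun _ => rfl⟩
  have hx0 : ∀ q, 0 ≤ x q := fun q => by
    have := wt_pos q.1; have := wt_pos (q.2 - q.1); have := hc q.1; have := hc (q.2 - q.1)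
    rw [hxd]
    positivity
  have hy0 : ∀ q, 0 ≤ y q := fun q => by
    have := wt_pos q.1; have := wt_pos (q.2 - q.1); have := hp q.2
    rw [hyd]
    positivity
  have hx : HasSum (fun q => x q ^ 2) (W * W) := by
    have h0 : ∀ k, 0 ≤ wt k ^ 2 * c k ^ 2 := fun k => by positivity
    have h := hasSum_mul_prod h0 h0 hW hW
    have h' := shiftEquiv.hasSum_iff.2 h
    convert! h' using 1
    ext q
    simp only [hxd, Function.comp_apply, shiftEquiv, Equiv.coe_fn_mk]
    ring
  have hz1 : HasSum (fun q : ℤ × ℤ => ((wt q.1) ^ 4)⁻¹ * p q.2 ^ 2) (S * P) := by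
    have h1 : ∀ k, 0 ≤ ((wt k) ^ 4)⁻¹ := fun k => inv_nonneg.2 (pow_nonneg (wt_pos k).le 4)
    have h2 : ∀ k, 0 ≤ p k ^ 2 := fun k => sq_nonneg _
    have h := hasSum_mul_prod h1 h2 hS hP
    exact h
  have hz2 : HasSum (fun q : ℤ × ℤ => ((wt (q.2 - q.1)) ^ 4)⁻¹ * p q.2 ^ 2) (S * P) := by
    have h := reflectEquiv.hasSum_iff.2 hz1
    convert! h using 1
  have hz := (hz1.add hz2).mul_left (1 / 2)
  -- `AB ≤ (A² + B²)/2` decouples the two inverse weights; each resulting double sum is a product of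
  -- single sums, up to the reflection `n ↦ k - n`.
  have hyz : ∀ q, y q ^ 2 ≤ 1 / 2 * (((wt q.1) ^ 4)⁻¹ * p q.2 ^ 2
      + ((wt (q.2 - q.1)) ^ 4)⁻¹ * p q.2 ^ 2) := fun q => by
    simp only [hyd, mul_pow, mul_inv, inv_pow]
    generalize hA : ((wt q.1) ^ 2)⁻¹ = A
    generalize hB : ((wt (q.2 - q.1)) ^ 2)⁻¹ = B
    have hA' : ((wt q.1) ^ 4)⁻¹ = A ^ 2 := by rw [← hA, ← inv_pow, ← inv_pow, ← pow_mul]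
    have hB' : ((wt (q.2 - q.1)) ^ 4)⁻¹ = B ^ 2 := by rw [← hB, ← inv_pow, ← inv_pow, ← pow_mul]
    rw [hA', hB']
    nlinarith [mul_nonneg (sq_nonneg (p q.2)) (sq_nonneg (A - B))]
  have hys : Summable fun q => y q ^ 2 := hz.summable.of_nonneg_of_le (fun q => by positivity) hyz
  have hyle : ∑' q, y q ^ 2 ≤ S * P := by
    have h := hasSum_le hyz hys.hasSum hz
    linarith
  obtain ⟨h1, h2⟩ := summable_mul_and_tsum_mul_le hx0 hy0 hx.summable hys
  have hxy : (fun q => x q * y q) = fun q : ℤ × ℤ => c q.1 * (p q.2 * c (q.2 - q.1)) := by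
    ext q
    have := (wt_pos q.1).ne'; have := (wt_pos (q.2 - q.1)).ne'
    simp only [hxd, hyd]
    field_simp
  rw [hxy] at h1 h2
  rw [hx.tsum_eq, Real.sqrt_mul_self hW0] at h2
  have h3 : W * Real.sqrt (∑' q, y q ^ 2) ≤ W * Real.sqrt (S * P) := by gcongr
  rw [Real.sqrt_mul hS0] at h3
  exact ⟨h1, by linarith⟩

/-- The `L⁴` bound, in trilinear form. -/
lemma norm_inner_mulL2_self_le {V : C(Torus, ℂ)} {c : ℤ → ℂ}
    (hV : HasSum (fun k : ℤ => c k • (fourier k : C(Torus, ℂ))) V)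
    (hw : Summable fun k => wt k ^ 2 * ‖c k‖ ^ 2) (p : L2) :
    ‖inner ℂ p (mulL2 V (toL2 V))‖ ≤ (2 * Real.pi * Real.sqrt (∑' k, ((wt k) ^ 4)⁻¹)) * ‖p‖
      * ∑' k, wt k ^ 2 * ‖c k‖ ^ 2 := by
  have hpi := Real.two_pi_pos
  have hcoef : ∀ k, coef k (toL2 V) = c k := coef_of_hasSum hV
  have h := (((innerSL ℂ p).comp (mulL2.flip (toL2 V)))).hasSum hV
  have hval : ∀ g : C(Torus, ℂ),
    ((innerSL ℂ p).comp (mulL2.flip (toL2 V))) g = inner ℂ p (mulL2 g (toL2 V)) := fun _ => rfl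
  simp only [map_smul] at h
  simp only [hval] at h
  obtain ⟨h1, h2⟩ := tsum_conv_le (c := fun k => ‖c k‖) (p := fun k => ‖coef k p‖)
    (fun k => norm_nonneg _) (fun k => norm_nonneg _) hw (summable_sq_coef p)
  have hfib : ∀ n, ‖c n • inner ℂ p (mulL2 (fourier n) (toL2 V))‖
      ≤ 2 * Real.pi * ∑' k, ‖c n‖ * (‖coef k p‖ * ‖c (k - n)‖) := fun n => by
    rw [norm_smul, tsum_mul_left, mul_left_comm (2 * Real.pi)]
    -- Summability of the fibre follows from that of the double sum only after division by `‖c n‖`.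
    by_cases hn : c n = 0
    · simp [hn]
    have hs : Summable fun k => ‖coef k p‖ * ‖c (k - n)‖ := by
      have := h1.prod_factor n
      exact (summable_mul_left_iff (norm_ne_zero_iff.2 hn)).1 this
    gcongr
    refine norm_inner_le_tsum hs fun k => ?_
    rw [coef_mulL2_fourier, hcoef]
  have hs2 := h1.prod
  have h3 : ‖inner ℂ p (mulL2 V (toL2 V))‖ ≤
      2 * Real.pi * ∑' q : ℤ × ℤ, ‖c q.1‖ * (‖coef q.2 p‖ * ‖c (q.2 - q.1)‖) := by
    rw [← h.tsum_eq, h1.tsum_prod, ← tsum_mul_left]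
    exact tsum_of_norm_bounded (hs2.mul_left _).hasSum hfib
  refine h3.trans ?_
  have h4 : Real.sqrt (∑' k, ‖coef k p‖ ^ 2) ≤ ‖p‖ := by
    rw [Real.sqrt_le_left (norm_nonneg _), (hasSum_sq_coef p).tsum_eq]
    exact mul_le_of_le_one_left (by positivity)
      (inv_le_one_of_one_le₀ (by nlinarith [Real.pi_gt_three]))
  have hW0 : 0 ≤ ∑' k, wt k ^ 2 * ‖c k‖ ^ 2 := tsum_nonneg fun k => by positivity
  calc _ ≤ 2 * Real.pi * (Real.sqrt (∑' k, ((wt k) ^ 4)⁻¹)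
        * Real.sqrt (∑' k, ‖coef k p‖ ^ 2) * ∑' k, wt k ^ 2 * ‖c k‖ ^ 2) := by gcongr
    _ ≤ 2 * Real.pi * (Real.sqrt (∑' k, ((wt k) ^ 4)⁻¹)
        * ‖p‖ * ∑' k, wt k ^ 2 * ‖c k‖ ^ 2) := by gcongr
    _ = _ := by ring

/-- Interpolation of the weight `(1 + |k|)^{3/4}` for functions of mean zero. -/
lemma summable_and_tsum_wt_le {u : L2} (h0 : coef 0 u = 0)
    (hu : Summable fun k : ℤ => |(k : ℝ)| * ‖coef k u‖ ^ 2) {t : ℝ} (ht : 0 < t) :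
    (Summable fun k => wt k ^ 2 * ‖coef k u‖ ^ 2) ∧
      2 * Real.pi * ∑' k, wt k ^ 2 * ‖coef k u‖ ^ 2 ≤ 2 * t * halfSq u + (t ^ 3)⁻¹ * ‖u‖ ^ 2 := by
  have hle : ∀ k : ℤ, wt k ^ 2 * ‖coef k u‖ ^ 2
      ≤ 2 * t * (|(k : ℝ)| * ‖coef k u‖ ^ 2) + (t ^ 3)⁻¹ * ‖coef k u‖ ^ 2 := fun k => by
    by_cases hk : k = 0
    · subst hk; simp [h0]
    -- Since the zero mode is absent, `1 + |k| ≤ 2|k|`; this is the factor `2` in `2 * t`.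
    have h1 : (1 : ℝ) ≤ |(k : ℝ)| := by exact_mod_cast Int.one_le_abs hk
    have h2 := rpow_three_quarters_le (x := 1 + |(k : ℝ)|) (by positivity) ht
    rw [wt_sq, ← mul_assoc, ← add_mul]
    gcongr
    nlinarith
  have hs := (hu.mul_left (2 * t)).add ((summable_sq_coef u).mul_left (t ^ 3)⁻¹)
  have hs0 := hs.of_nonneg_of_le (fun k => by positivity) hle
  refine ⟨hs0, ?_⟩
  have h := hs0.tsum_le_tsum hle hs
  rw [(hu.mul_left (2 * t)).tsum_add ((summable_sq_coef u).mul_left (t ^ 3)⁻¹), tsum_mul_left,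
    tsum_mul_left] at h
  refine (mul_le_mul_of_nonneg_left h Real.two_pi_pos.le).trans_eq ?_
  rw [halfSq, norm_sq_eq_tsum]
  ring

/-! ### The energy identity for `H²` functions. -/

/-- A real-valued function `V` of mean zero in `H²(𝕋)`, with its derivatives `V1` and `u2`. -/
structure IsH2 (V V1 : C(Torus, ℂ)) (u2 : L2) : Prop where
  hasSum : HasSum (fun k : ℤ => coef k (toL2 V) • (fourier k : C(Torus, ℂ))) V
  deriv : HasTorusDeriv V V1
  star_eq : star V = V
  mean : coef 0 (toL2 V) = 0
  coef_two : ∀ k : ℤ, coef k u2 = Complex.I * k * coef k (toL2 V1)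

/-- The operator `G` on `L²(𝕋)`, for a real continuous function `A`. -/
def opGL2 (A : C(Torus, ℂ)) : L2 →L[ℂ] L2 :=
  mulL2 A - (innerSL ℂ (toL2 A)).smulRight (toL2 A)

lemma opGL2_apply (A : C(Torus, ℂ)) (f : L2) :
    opGL2 A f = mulL2 A f - (inner ℂ (toL2 A) f : ℂ) • toL2 A := rfl

lemma inner_opGL2_left {A : C(Torus, ℂ)} (hA : star A = A) (f g : L2) :
    inner ℂ (opGL2 A f) g = inner ℂ f (opGL2 A g) := by
  rw [opGL2_apply, opGL2_apply, inner_sub_left, inner_sub_right, inner_mulL2_left, hA,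
    inner_smul_left, inner_smul_right, inner_conj_symm]
  ring

/-- The derivative of `G V`, where `A1` and `V1` are the derivatives of `A` and `V`. -/
def derivG (A A1 V V1 : C(Torus, ℂ)) : C(Torus, ℂ) :=
  A1 * V + A * V1 - (inner ℂ (toL2 A) (toL2 V) : ℂ) • A1

lemma hasTorusDeriv_derivG {A A1 V V1 : C(Torus, ℂ)} (hA : HasTorusDeriv A A1)
    (hV : HasTorusDeriv V V1) :
    HasTorusDeriv (A * V - (inner ℂ (toL2 A) (toL2 V) : ℂ) • A) (derivG A A1 V V1) :=
  (hA.mul hV).sub (hA.const_smul _)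

lemma opGL2_toL2 (A V : C(Torus, ℂ)) :
    opGL2 A (toL2 V) = toL2 (A * V - (inner ℂ (toL2 A) (toL2 V) : ℂ) • A) := by
  rw [opGL2_apply, mulL2_toL2, map_sub, map_smul]

/-- This is `D = H∂`; it realizes `D f` as the Hilbert transform of a classical derivative. -/
lemma HasTorusDeriv.coef_hilbL2 {f f1 : C(Torus, ℂ)} (hf : HasTorusDeriv f f1) (k : ℤ) :
    coef k (hilbL2 (toL2 f1)) = |(k : ℝ)| * coef k (toL2 f) := by
  rw [BenjaminOno.coef_hilbL2, hf.coef_eq]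
  have h : ((Int.sign k : ℤ) : ℂ) * (k : ℂ) = (|(k : ℝ)| : ℝ) := by
    rw [← Int.cast_mul, Int.sign_mul_self_eq_abs, ← Int.cast_abs, Complex.ofReal_intCast]
  rw [← h]
  linear_combination (-((Int.sign k : ℤ) : ℂ) * k * coef k (toL2 f)) * Complex.I_sq

lemma coef_opGL2_deriv {A A1 V V1 : C(Torus, ℂ)} (hA : HasTorusDeriv A A1)
    (hV : HasTorusDeriv V V1) (k : ℤ) :
    coef k (hilbL2 (toL2 (derivG A A1 V V1))) = |(k : ℝ)| * coef k (opGL2 A (toL2 V)) := by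
  rw [opGL2_toL2]
  exact (hasTorusDeriv_derivG hA hV).coef_hilbL2 k

/-- The time derivative `-(H - ε) v_xx - α v v_x - G D G v` that the equation prescribes. -/
def timeDeriv (A A1 : C(Torus, ℂ)) (ε α : ℝ) (V V1 : C(Torus, ℂ)) (u2 : L2) : L2 :=
  -hilbL2 u2 + (ε : ℂ) • u2 - (α : ℂ) • toL2 (V * V1)
    - opGL2 A (hilbL2 (toL2 (derivG A A1 V V1)))

/-- Integration by parts. -/
lemma HasTorusDeriv.inner_eq_neg {f f1 : C(Torus, ℂ)} (hf : HasTorusDeriv f f1) {h w : L2}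
    (hw : ∀ k : ℤ, coef k w = Complex.I * k * coef k h) :
    inner ℂ (toL2 f) w = -inner ℂ (toL2 f1) h := by
  rw [← inner_neg_right]
  refine inner_eq_inner_of_coef fun k => ?_
  rw [hw, hf.coef_eq, map_neg, map_mul, map_mul, Complex.conj_I, map_intCast]
  ring

lemma norm_toL2_mul_le (g f : C(Torus, ℂ)) : ‖toL2 (g * f)‖ ≤ ‖mulL2 g‖ * ‖toL2 f‖ := by
  rw [← mulL2_toL2]
  exact (mulL2 g).le_opNorm _

lemma IsH2.coef_hilbL2_two {V V1 : C(Torus, ℂ)} {u2 : L2} (h : IsH2 V V1 u2) (k : ℤ) :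
    coef k (hilbL2 u2) = Complex.I * k * coef k (hilbL2 (toL2 V1)) := by
  rw [BenjaminOno.coef_hilbL2, BenjaminOno.coef_hilbL2, h.coef_two]
  ring

/-- Poincaré's inequality. -/
lemma IsH2.norm_le {V V1 : C(Torus, ℂ)} {u2 : L2} (h : IsH2 V V1 u2) :
    ‖toL2 V‖ ≤ ‖toL2 V1‖ := by
  refine abs_le_of_sq_le_sq' ?_ (norm_nonneg _) |>.2
  rw [norm_sq_eq_tsum, norm_sq_eq_tsum]
  refine mul_le_mul_of_nonneg_left ?_ Real.two_pi_pos.le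
  refine (summable_sq_coef _).tsum_le_tsum (fun k => ?_) (summable_sq_coef _)
  rw [h.deriv.coef_eq]
  by_cases hk : k = 0
  · subst hk; simp [h.mean]
  · have h1 : (1 : ℝ) ≤ |(k : ℝ)| := by exact_mod_cast Int.one_le_abs hk
    rw [norm_mul, norm_mul, Complex.norm_I, one_mul, Complex.norm_intCast]
    gcongr
    exact le_mul_of_one_le_left (norm_nonneg _) h1

lemma IsH2.summable_half {V V1 : C(Torus, ℂ)} {u2 : L2} (h : IsH2 V V1 u2) :
    Summable fun k : ℤ => |(k : ℝ)| * ‖coef k (toL2 V)‖ ^ 2 :=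
  summable_abs_mul_sq_coef h.deriv.coef_hilbL2

/-- The energy identity. -/
lemma IsH2.re_inner_timeDeriv {A A1 V V1 : C(Torus, ℂ)} {u2 : L2} (h : IsH2 V V1 u2)
    (hA : star A = A) (hA1 : HasTorusDeriv A A1) (ε α : ℝ) :
    (inner ℂ (toL2 V) (timeDeriv A A1 ε α V V1 u2)).re
      = -(ε * ‖toL2 V1‖ ^ 2) - halfSq (opGL2 A (toL2 V)) := by
  -- After one integration by parts this is `-(v_x, Hv_x)`, whose real part vanishes because `H` is
  -- skew-adjoint.
  have e1 : (inner ℂ (toL2 V) (hilbL2 u2)).re = 0 := by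
    rw [h.deriv.inner_eq_neg h.coef_hilbL2_two]
    have h1 : inner ℂ (toL2 V1) (hilbL2 (toL2 V1))
        = -conj (inner ℂ (toL2 V1) (hilbL2 (toL2 V1))) := by
      rw [inner_conj_symm, inner_hilbL2_left, neg_neg]
    have h2 := congrArg Complex.re h1
    rw [Complex.neg_re, Complex.conj_re] at h2
    rw [Complex.neg_re]
    linarith
  have e2 : inner ℂ (toL2 V) u2 = ((-‖toL2 V1‖ ^ 2 : ℝ) : ℂ) := by
    rw [h.deriv.inner_eq_neg h.coef_two, inner_self_eq_norm_sq_to_K]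
    push_cast
    rfl
  -- `3V²V_x` is the derivative of `V³`, so its integral is zero.
  have e3 : inner ℂ (toL2 V) (toL2 (V * V1)) = 0 := by
    have h3 := ((h.deriv.mul h.deriv).mul h.deriv).integral_eq_zero
    have h4 : (V1 * V + V * V1) * V + V * V * V1 = (3 : ℂ) • (V * (V * V1)) := by
      ext x
      simp
      ring
    rw [h4] at h3
    have h5 : ∫ x, ((3 : ℂ) • (V * (V * V1))) x = 3 * ∫ x, (V * (V * V1)) x :=
      integral_const_mul _ _
    rw [h5] at h3
    have h6 := (mul_eq_zero.1 h3).resolve_left (by norm_num)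
    rw [inner_toL2_toL2, ← h6]
    refine integral_congr_ae (Eventually.of_forall fun x => ?_)
    have : conj (V x) = V x := congrArg (fun f : C(Torus, ℂ) => f x) h.star_eq
    simp only [this, ContinuousMap.mul_apply]
  have e4 : inner ℂ (toL2 V) (opGL2 A (hilbL2 (toL2 (derivG A A1 V V1))))
      = ((halfSq (opGL2 A (toL2 V)) : ℝ) : ℂ) := by
    rw [← inner_opGL2_left hA]
    exact inner_eq_halfSq (coef_opGL2_deriv hA1 h.deriv)
  rw [timeDeriv, inner_sub_right, inner_sub_right, inner_add_right, inner_neg_right,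
    inner_smul_right, inner_smul_right, e2, e3, e4, ← Complex.ofReal_mul]
  simp only [Complex.sub_re, Complex.add_re, Complex.neg_re, e1, Complex.ofReal_re, mul_zero,
    Complex.zero_re]
  ring

/-! ### The terms paired with `Bv`. -/

/-- The sum `∑ (1 + n²) |ĝ_n|`. -/
def decayNorm (g : C(Torus, ℂ)) : ℝ := ∑' n : ℤ, (1 + (n : ℝ) ^ 2) * ‖coef n (toL2 g)‖

lemma decayNorm_nonneg (g : C(Torus, ℂ)) : 0 ≤ decayNorm g :=
  tsum_nonneg fun _ => by positivity

lemma fastDecay_one : FastDecay 1 := by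
  have h := fastDecay_smoothC (g := fun _ => 1) contDiff_const
  convert! h using 1

lemma hasTorusDeriv_one : HasTorusDeriv 1 0 := fun x => hasDerivAt_const x 1

lemma sqrt_sq_add_sq_le {x y : ℝ} (hx : 0 ≤ x) (hy : 0 ≤ y) :
    Real.sqrt (x + y ^ 2) ≤ Real.sqrt x + y := by
  rw [Real.sqrt_le_left (by positivity), add_sq, Real.sq_sqrt hx]
  have : 0 ≤ Real.sqrt x := Real.sqrt_nonneg x
  nlinarith [mul_nonneg this hy]

lemma mulL2_one (f : L2) : mulL2 1 f = f := by
  refine ext_coef fun k => ?_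
  have : (1 : C(Torus, ℂ)) = fourier 0 := by ext x; simp
  rw [this, coef_mulL2_fourier, sub_zero]

/-- Half-derivative pairing with `u`, up to lower-order terms. -/
lemma FastDecay.norm_inner_mulL2_le_add {g : C(Torus, ℂ)} (hg : FastDecay g) {u f Df : L2}
    (hu : Summable fun k : ℤ => |(k : ℝ)| * ‖coef k u‖ ^ 2)
    (hf : ∀ k : ℤ, coef k Df = |(k : ℝ)| * coef k f) :
    ‖inner ℂ Df (mulL2 g u)‖
      ≤ decayNorm g * (Real.sqrt (halfSq f) * (Real.sqrt (halfSq u) + ‖u‖)) := by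
  refine (hg.norm_inner_mulL2_le hu hf).trans ?_
  rw [← decayNorm]
  have := decayNorm_nonneg g
  gcongr
  exact sqrt_sq_add_sq_le (halfSq_nonneg u) (norm_nonneg u)

/-- The `H^{1/2}` size of the constant function `1`. -/
def oneSize : ℝ := Real.sqrt (halfSq (toL2 1)) + ‖toL2 1‖

lemma oneSize_nonneg : 0 ≤ oneSize := by unfold oneSize; positivity

/-- The preceding bound with `u = 1`. It handles the mean terms of `G`, where `Df` is paired with a
fixed function. -/
lemma FastDecay.norm_inner_le {g : C(Torus, ℂ)} (hg : FastDecay g) {f Df : L2}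
    (hf : ∀ k : ℤ, coef k Df = |(k : ℝ)| * coef k f) :
    ‖inner ℂ Df (toL2 g)‖ ≤ decayNorm g * oneSize * Real.sqrt (halfSq f) := by
  have h := hg.norm_inner_mulL2_le_add
    (summable_abs_mul_sq_coef hasTorusDeriv_one.coef_hilbL2) hf
  rw [mulL2_toL2, mul_one] at h
  refine h.trans_eq ?_
  rw [oneSize]
  ring

/-- The dispersive term controls the `H^{1/2}` norm. -/
lemma exists_dispersive_le {A A1 B : C(Torus, ℂ)} (hA1 : HasTorusDeriv A A1) (hAd : FastDecay A)
    (hB : star B = B) (hBd : FastDecay B) {κ : ℝ}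
    (hB1 : HasTorusDeriv B (A - (κ : ℂ) • (1 : C(Torus, ℂ)))) :
    ∃ K : ℝ, 0 ≤ K ∧ ∀ (V V1 : C(Torus, ℂ)) (u2 : L2), IsH2 V V1 u2 →
      -(inner ℂ (toL2 (B * V)) (hilbL2 u2)).re ≤ -(κ * halfSq (toL2 V))
        + K * (Real.sqrt (halfSq (toL2 V)) * Real.sqrt (halfSq (opGL2 A (toL2 V)))
          + Real.sqrt (halfSq (toL2 V)) * ‖toL2 V‖ + ‖toL2 V‖ ^ 2) := by
  have h1n := decayNorm_nonneg 1
  have hAn := decayNorm_nonneg A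
  have hBn := decayNorm_nonneg B
  have ho := oneSize_nonneg
  set K1 := decayNorm 1 with hK1
  set K2 := K1 * ‖opGL2 A‖ with hK2
  set K3 := decayNorm A * oneSize * ‖toL2 A‖ with hK3
  have hK2n : 0 ≤ K2 := by positivity
  have hK3n : 0 ≤ K3 := by positivity
  refine ⟨K1 + K2 + K3 + decayNorm B, by positivity, fun V V1 u2 h => ?_⟩
  have hDu := h.deriv.coef_hilbL2
  set D := hilbL2 (toL2 V1) with hD
  set u := toL2 V with hu
  set X := Real.sqrt (halfSq u) with hX
  set Y := Real.sqrt (halfSq (opGL2 A u)) with hY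
  have hX0 : 0 ≤ X := Real.sqrt_nonneg _
  have hY0 : 0 ≤ Y := Real.sqrt_nonneg _
  -- Integration by parts with `B' = A - κ`, the product `AV` being rewritten as `GV + (A, V) A`.
  -- The term in `κ` is the gain.
  have e1 : inner ℂ (toL2 (B * V)) (hilbL2 u2)
      = -(inner ℂ (opGL2 A u) D + conj (inner ℂ (toL2 A) u) * inner ℂ (toL2 A) D
        - κ * inner ℂ u D + inner ℂ (mulL2 B (toL2 V1)) D) := by
    rw [(hB1.mul h.deriv).inner_eq_neg h.coef_hilbL2_two]
    have h2 : toL2 ((A - (κ : ℂ) • (1 : C(Torus, ℂ))) * V + B * V1)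
        = opGL2 A u + (inner ℂ (toL2 A) u : ℂ) • toL2 A - (κ : ℂ) • u + mulL2 B (toL2 V1) := by
      rw [opGL2_apply, sub_add_cancel, mulL2_toL2, hu, mulL2_toL2, ← map_smul, ← map_sub, ← map_add]
      congr 2
      ext x
      simp
      ring
    rw [h2, inner_add_left, inner_sub_left, inner_add_left, inner_smul_left, inner_smul_left,
      Complex.conj_ofReal]
  have e2 : inner ℂ u D = (halfSq u : ℂ) := inner_eq_halfSq hDu
  -- The multiplication bound with the function `1`: only the splitting of `D` into two
  -- half-derivatives is used.
  have b1 : ‖inner ℂ (opGL2 A u) D‖ ≤ K1 * (X * Y) + K2 * (X * ‖u‖) := by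
    have h3 := fastDecay_one.norm_inner_mulL2_le_add
      (summable_abs_mul_sq_coef (coef_opGL2_deriv hA1 h.deriv)) hDu
    rw [mulL2_one, norm_inner_symm] at h3
    refine h3.trans ?_
    have h4 : ‖opGL2 A u‖ ≤ ‖opGL2 A‖ * ‖u‖ := (opGL2 A).le_opNorm u
    calc _ ≤ K1 * (X * (Y + ‖opGL2 A‖ * ‖u‖)) := by gcongr
      _ = _ := by rw [hK2]; ring
  have b2 : ‖conj (inner ℂ (toL2 A) u) * inner ℂ (toL2 A) D‖ ≤ K3 * (X * ‖u‖) := by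
    rw [norm_mul, RCLike.norm_conj]
    have h3 := hAd.norm_inner_le hDu
    rw [norm_inner_symm] at h3
    have h4 : ‖inner ℂ (toL2 A) u‖ ≤ ‖toL2 A‖ * ‖u‖ := norm_inner_le_norm _ _
    calc _ ≤ (‖toL2 A‖ * ‖u‖) * (decayNorm A * oneSize * X) := by gcongr
      _ = _ := by rw [hK3]; ring
  have b3 := hBd.abs_re_inner_hilbL2_le hB h.deriv.coef_eq
  rw [← decayNorm] at b3
  have b1' := (Complex.re_le_norm _).trans b1
  have b2' := (Complex.re_le_norm _).trans b2
  have b3' := (le_abs_self _).trans b3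
  rw [e1, e2, Complex.neg_re, neg_neg, Complex.add_re, Complex.sub_re, Complex.add_re,
    ← Complex.ofReal_mul, Complex.ofReal_re]
  have n1 := mul_nonneg hX0 hY0
  have n2 := mul_nonneg hX0 (norm_nonneg u)
  have n3 := sq_nonneg ‖u‖
  have := mul_nonneg h1n n2; have := mul_nonneg h1n n3; have := mul_nonneg hK2n n1
  have := mul_nonneg hK2n n3; have := mul_nonneg hK3n n1; have := mul_nonneg hK3n n3
  have := mul_nonneg hBn n1; have := mul_nonneg hBn n2
  linarith

/-- The viscous term. -/
lemma exists_viscous_le {B B1 : C(Torus, ℂ)} (hB1 : HasTorusDeriv B B1) :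
    ∃ K : ℝ, 0 ≤ K ∧ ∀ (V V1 : C(Torus, ℂ)) (u2 : L2), IsH2 V V1 u2 →
      (inner ℂ (toL2 (B * V)) u2).re ≤ K * ‖toL2 V1‖ ^ 2 := by
  refine ⟨‖mulL2 B1‖ + ‖mulL2 B‖, by positivity, fun V V1 u2 h => ?_⟩
  rw [(hB1.mul h.deriv).inner_eq_neg h.coef_two]
  refine (Complex.re_le_norm _).trans ?_
  rw [norm_neg]
  refine (norm_inner_le_norm _ _).trans ?_
  rw [map_add, sq, ← mul_assoc]
  gcongr
  refine (norm_add_le _ _).trans ?_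
  rw [add_mul]
  gcongr
  · exact (norm_toL2_mul_le _ _).trans (by gcongr; exact h.norm_le)
  · exact norm_toL2_mul_le _ _

/-- The nonlinear term. -/
lemma exists_nonlinear_le {B B1 : C(Torus, ℂ)} (hB : star B = B) (hB1 : HasTorusDeriv B B1) :
    ∃ K : ℝ, 0 ≤ K ∧ ∀ (V V1 : C(Torus, ℂ)) (u2 : L2), IsH2 V V1 u2 → ∀ t : ℝ, 0 < t →
      ‖inner ℂ (toL2 (B * V)) (toL2 (V * V1))‖ ≤
        K * (‖toL2 V‖ * (2 * t * halfSq (toL2 V) + (t ^ 3)⁻¹ * ‖toL2 V‖ ^ 2)) := by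
  refine ⟨Real.sqrt (∑' k, ((wt k) ^ 4)⁻¹) * ‖mulL2 (star B1)‖, by positivity,
    fun V V1 u2 h t ht => ?_⟩
  have hVs : ∀ x, conj (V x) = V x := fun x => congrArg (fun f : C(Torus, ℂ) => f x) h.star_eq
  have hBs : ∀ x, conj (B x) = B x := fun x => congrArg (fun f : C(Torus, ℂ) => f x) hB
  -- Integrating the derivative of `BV³` gives `∫BV²V_x = -(1/3)∫B'V³`, which removes the derivative
  -- from `V`.
  have e1 : inner ℂ (toL2 (B * V)) (toL2 (V * V1))
      = -(1 / 3) * inner ℂ (toL2 (star B1 * V)) (mulL2 V (toL2 V)) := by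
    have h3 := (hB1.mul ((h.deriv.mul h.deriv).mul h.deriv)).integral_eq_zero
    have h4 : B1 * (V * V * V) + B * ((V1 * V + V * V1) * V + V * V * V1)
        = (3 : ℂ) • (B * V * (V * V1)) + B1 * V * (V * V) := by
      ext x
      simp
      ring
    have h5 : ∫ x, ((3 : ℂ) • (B * V * (V * V1)) + B1 * V * (V * V)) x
        = 3 * (∫ x, (B * V * (V * V1)) x) + ∫ x, (B1 * V * (V * V)) x := by
      rw [← integral_const_mul, ← integral_add ((integrable_coe _).const_mul _) (integrable_coe _)]
      rfl
    rw [h4, h5] at h3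
    have h6 : inner ℂ (toL2 (B * V)) (toL2 (V * V1)) = ∫ x, (B * V * (V * V1)) x := by
      rw [inner_toL2_toL2]
      refine integral_congr_ae (Eventually.of_forall fun x => ?_)
      simp only [ContinuousMap.mul_apply, map_mul, hVs, hBs]
    have h7 : inner ℂ (toL2 (star B1 * V)) (mulL2 V (toL2 V)) = ∫ x, (B1 * V * (V * V)) x := by
      rw [mulL2_toL2, inner_toL2_toL2]
      refine integral_congr_ae (Eventually.of_forall fun x => ?_)
      simp only [ContinuousMap.mul_apply, map_mul, hVs, ContinuousMap.star_apply, RCLike.star_def,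
        Complex.conj_conj]
    rw [h6, h7]
    linear_combination (1 / 3) * h3
  obtain ⟨hs, hle⟩ := summable_and_tsum_wt_le h.mean h.summable_half ht
  have h1 := norm_inner_mulL2_self_le h.hasSum hs (toL2 (star B1 * V))
  have h2 : ‖toL2 (star B1 * V)‖ ≤ ‖mulL2 (star B1)‖ * ‖toL2 V‖ := norm_toL2_mul_le _ _
  rw [e1, norm_mul]
  have h3 : ‖(-(1 / 3) : ℂ)‖ ≤ 1 := by norm_num
  have hq : 0 ≤ Real.sqrt (∑' k, ((wt k) ^ 4)⁻¹) := Real.sqrt_nonneg _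
  calc _ ≤ 1 * (2 * Real.pi * Real.sqrt (∑' k, ((wt k) ^ 4)⁻¹) * ‖toL2 (star B1 * V)‖
        * ∑' k, wt k ^ 2 * ‖coef k (toL2 V)‖ ^ 2) := by gcongr
    _ = Real.sqrt (∑' k, ((wt k) ^ 4)⁻¹) * ‖toL2 (star B1 * V)‖ *
        (2 * Real.pi * ∑' k, wt k ^ 2 * ‖coef k (toL2 V)‖ ^ 2) := by ring
    _ ≤ Real.sqrt (∑' k, ((wt k) ^ 4)⁻¹) * (‖mulL2 (star B1)‖ * ‖toL2 V‖) *
        (2 * t * halfSq (toL2 V) + (t ^ 3)⁻¹ * ‖toL2 V‖ ^ 2) := by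
      gcongr
    _ = _ := by ring

/-- The damping term. -/
lemma exists_damping_le {A A1 B : C(Torus, ℂ)} (hA : star A = A) (hA1 : HasTorusDeriv A A1)
    (hAd : FastDecay A) (hABd : FastDecay (A * B)) :
    ∃ K : ℝ, 0 ≤ K ∧ ∀ (V V1 : C(Torus, ℂ)) (u2 : L2), IsH2 V V1 u2 →
      ‖inner ℂ (toL2 (B * V)) (opGL2 A (hilbL2 (toL2 (derivG A A1 V V1))))‖ ≤
        K * (Real.sqrt (halfSq (toL2 V)) * Real.sqrt (halfSq (opGL2 A (toL2 V)))
          + Real.sqrt (halfSq (opGL2 A (toL2 V))) * ‖toL2 V‖) := by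
  have hAn := decayNorm_nonneg A
  have hABn := decayNorm_nonneg (A * B)
  have ho := oneSize_nonneg
  set K1 := decayNorm (A * B)
  set K2 := decayNorm A * oneSize * (‖toL2 A‖ * ‖mulL2 B‖) with hK2
  have hK2n : 0 ≤ K2 := by positivity
  refine ⟨K1 + K2, by positivity, fun V V1 u2 h => ?_⟩
  have hN := coef_opGL2_deriv hA1 h.deriv
  set N := hilbL2 (toL2 (derivG A A1 V V1))
  set u := toL2 V with hu
  set X := Real.sqrt (halfSq u) with hX
  set Y := Real.sqrt (halfSq (opGL2 A u)) with hY
  have hX0 : 0 ≤ X := Real.sqrt_nonneg _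
  have hY0 : 0 ≤ Y := Real.sqrt_nonneg _
  -- `G` is moved to the left factor; `G(BV)` is then `(AB)V` up to a multiple of `A`, and both pair
  -- with `D G V` at the cost of one half-derivative of `GV`.
  have e1 : opGL2 A (toL2 (B * V))
      = mulL2 (A * B) u - (inner ℂ (toL2 A) (toL2 (B * V)) : ℂ) • toL2 A := by
    rw [opGL2_apply, mulL2_toL2, hu, mulL2_toL2, mul_assoc]
  rw [← inner_opGL2_left hA, e1, norm_inner_symm, inner_sub_right, inner_smul_right]
  refine (norm_sub_le _ _).trans ?_
  have b1 := hABd.norm_inner_mulL2_le_add h.summable_half hN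
  have b2 : ‖inner ℂ (toL2 A) (toL2 (B * V)) * inner ℂ N (toL2 A)‖ ≤ K2 * (Y * ‖u‖) := by
    rw [norm_mul]
    have h3 := hAd.norm_inner_le hN
    have h4 : ‖inner ℂ (toL2 A) (toL2 (B * V))‖ ≤ ‖toL2 A‖ * (‖mulL2 B‖ * ‖u‖) :=
      (norm_inner_le_norm _ _).trans (by gcongr; exact norm_toL2_mul_le _ _)
    calc _ ≤ (‖toL2 A‖ * (‖mulL2 B‖ * ‖u‖)) * (decayNorm A * oneSize * Y) := by gcongr
      _ = _ := by rw [hK2]; ring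
  have := mul_nonneg hK2n (mul_nonneg hX0 hY0)
  refine (add_le_add b1 b2).trans ?_
  nlinarith

/-- The fraction `κ/8` is chosen for the final budget: two uses of this bound and the `κ/4` of the
nonlinear term consume `κ/2` of the gain `κ`. -/
lemma mul_mul_le_young {K κ x y : ℝ} (hκ : 0 < κ) :
    K * (x * y) ≤ κ / 8 * x ^ 2 + 2 * K ^ 2 / κ * y ^ 2 := by
  have h : κ / 8 * x ^ 2 + 2 * K ^ 2 / κ * y ^ 2 - K * (x * y)
      = (κ * x - 4 * K * y) ^ 2 / (8 * κ) := by
    field_simp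
    ring
  have : 0 ≤ (κ * x - 4 * K * y) ^ 2 / (8 * κ) := by positivity
  linarith

lemma exists_nonlinear_le_young {B B1 : C(Torus, ℂ)} (hB : star B = B) (hB1 : HasTorusDeriv B B1)
    {κ : ℝ} (hκ : 0 < κ) :
    ∃ K : ℝ, 0 ≤ K ∧ ∀ (V V1 : C(Torus, ℂ)) (u2 : L2), IsH2 V V1 u2 → ∀ α R : ℝ, 0 < R →
      ‖toL2 V‖ ≤ R →
      |α| * ‖inner ℂ (toL2 (B * V)) (toL2 (V * V1))‖ ≤
        κ / 4 * halfSq (toL2 V) + K * (α ^ 4 * R ^ 6) := by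
  obtain ⟨K, hK, h⟩ := exists_nonlinear_le hB hB1
  refine ⟨512 * (K + 1) ^ 4 / κ ^ 3, by positivity, fun V V1 u2 hV α R hR hVR => ?_⟩
  have hX := halfSq_nonneg (toL2 V)
  rcases eq_or_ne α 0 with rfl | hα
  · rw [abs_zero, zero_mul]
    positivity
  have hα' : 0 < |α| := abs_pos.2 hα
  -- This `t` makes the coefficient of the `H^{1/2}` term exactly `κ/4`; then `|α| R · t⁻³ R²` is a
  -- multiple of `α⁴R⁶`, and `512 = 8³`. Using `K + 1` avoids a division by zero when `K = 0`.
  have ht : 0 < κ / (8 * (K + 1) * |α| * R) := by positivity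
  have h1 := h V V1 u2 hV _ ht
  have hr := norm_nonneg (toL2 V)
  set t := κ / (8 * (K + 1) * |α| * R) with ht'
  have e1 : |α| * ((K + 1) * (R * (2 * t))) = κ / 4 := by
    rw [ht']
    field_simp
    norm_num
  have e2 : |α| * ((K + 1) * (R * ((t ^ 3)⁻¹ * R ^ 2)))
      = 512 * (K + 1) ^ 4 / κ ^ 3 * (α ^ 4 * R ^ 6) := by
    have : α ^ 4 = |α| ^ 4 := by rw [← abs_pow, abs_of_nonneg (by positivity)]
    rw [ht', this]
    field_simp
    norm_num
  calc _ ≤ |α| * (K * (‖toL2 V‖ * (2 * t * halfSq (toL2 V) + (t ^ 3)⁻¹ * ‖toL2 V‖ ^ 2))) := by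
        gcongr
    _ ≤ |α| * ((K + 1) * (R * (2 * t * halfSq (toL2 V) + (t ^ 3)⁻¹ * R ^ 2))) := by
        gcongr
        linarith
    _ = |α| * ((K + 1) * (R * (2 * t))) * halfSq (toL2 V)
        + |α| * ((K + 1) * (R * ((t ^ 3)⁻¹ * R ^ 2))) := by ring
    _ = _ := by rw [e1, e2]

/-- The local smoothing inequality at a fixed time. -/
lemma exists_smoothing_le {A A1 B : C(Torus, ℂ)} (hA : star A = A) (hA1 : HasTorusDeriv A A1)
    (hAd : FastDecay A) (hB : star B = B) (hBd : FastDecay B) (hABd : FastDecay (A * B))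
    {κ : ℝ} (hκ : 0 < κ) (hB1 : HasTorusDeriv B (A - (κ : ℂ) • (1 : C(Torus, ℂ)))) :
    ∃ M : ℝ, 0 ≤ M ∧ ∀ (V V1 : C(Torus, ℂ)) (u2 : L2), IsH2 V V1 u2 →
      ∀ ε α R : ℝ, 0 < ε → 0 < R → ‖toL2 V‖ ≤ R →
      (inner ℂ (mulL2 B (toL2 V)) (timeDeriv A A1 ε α V V1 u2)).re
        + M * (inner ℂ (toL2 V) (timeDeriv A A1 ε α V V1 u2)).re
        ≤ -(κ / 2 * halfSq (toL2 V)) + M * (R ^ 2 + α ^ 4 * R ^ 6) := by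
  obtain ⟨K1, hK1, h1⟩ := exists_dispersive_le hA1 hAd hB hBd hB1
  obtain ⟨K2, hK2, h2⟩ := exists_viscous_le hB1
  obtain ⟨K3, hK3, h3⟩ := exists_nonlinear_le_young hB hB1 hκ
  obtain ⟨K4, hK4, h4⟩ := exists_damping_le hA hA1 hAd hABd
  set J := 2 * (K1 + K4) ^ 2 / κ with hJ
  set J1 := 2 * K1 ^ 2 / κ with hJ1
  have hJ0 : 0 ≤ J := by positivity
  have hJ10 : 0 ≤ J1 := by positivity
  -- One `M` does everything: `J + K4` absorbs `‖D^{1/2}Gv‖²`, `K2` absorbs `ε‖v_x‖²`, and `J1 + K1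
  -- + K4` and `K3` bound the coefficients of `R²` and `α⁴R⁶`.
  refine ⟨J + J1 + K1 + K2 + K3 + K4, by positivity, fun V V1 u2 h ε α R hε hR hVR => ?_⟩
  have e1 := h.re_inner_timeDeriv hA hA1 ε α
  have a1 := h1 V V1 u2 h
  have a2 := h2 V V1 u2 h
  have a3 := h3 V V1 u2 h α R hR hVR
  have a4 := h4 V V1 u2 h
  have hX0 := halfSq_nonneg (toL2 V)
  have hY0 := halfSq_nonneg (opGL2 A (toL2 V))
  have hXs := Real.sq_sqrt hX0
  have hYs := Real.sq_sqrt hY0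
  set X := Real.sqrt (halfSq (toL2 V))
  set Y := Real.sqrt (halfSq (opGL2 A (toL2 V)))
  have hr : ‖toL2 V‖ ^ 2 ≤ R ^ 2 := by gcongr
  rw [mulL2_toL2, e1]
  set r := ‖toL2 V‖
  set z := ‖toL2 V1‖
  have e2 : (inner ℂ (toL2 (B * V)) (timeDeriv A A1 ε α V V1 u2)).re
      = -(inner ℂ (toL2 (B * V)) (hilbL2 u2)).re + ε * (inner ℂ (toL2 (B * V)) u2).re
        - α * (inner ℂ (toL2 (B * V)) (toL2 (V * V1))).re
        - (inner ℂ (toL2 (B * V)) (opGL2 A (hilbL2 (toL2 (derivG A A1 V V1))))).re := by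
    rw [timeDeriv, inner_sub_right, inner_sub_right, inner_add_right, inner_neg_right,
      inner_smul_right, inner_smul_right]
    simp only [Complex.sub_re, Complex.add_re, Complex.neg_re, Complex.re_ofReal_mul]
  have a2' : ε * (inner ℂ (toL2 (B * V)) u2).re ≤ ε * (K2 * z ^ 2) := by gcongr
  have a3' : -(α * (inner ℂ (toL2 (B * V)) (toL2 (V * V1))).re)
      ≤ |α| * ‖inner ℂ (toL2 (B * V)) (toL2 (V * V1))‖ := by
    refine (neg_le_abs _).trans ?_
    rw [abs_mul]
    gcongr
    exact Complex.abs_re_le_norm _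
  have a4' : -(inner ℂ (toL2 (B * V)) (opGL2 A (hilbL2 (toL2 (derivG A A1 V V1))))).re
      ≤ K4 * (X * Y + Y * r) := ((neg_le_abs _).trans (Complex.abs_re_le_norm _)).trans a4
  have y1 := mul_mul_le_young (K := K1 + K4) (x := X) (y := Y) hκ
  have y2 := mul_mul_le_young (K := K1) (x := X) (y := r) hκ
  rw [← hJ] at y1
  rw [← hJ1] at y2
  have y3 : K4 * (Y * r) ≤ K4 * (Y ^ 2 + r ^ 2) := by
    gcongr
    nlinarith [sq_nonneg (Y - r), sq_nonneg Y, sq_nonneg r]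
  rw [e2]
  rw [hXs] at y1 y2
  rw [hYs] at y1 y3
  have hz : 0 ≤ ε * z ^ 2 := by positivity
  have hq : 0 ≤ α ^ 4 * R ^ 6 := by positivity
  have hrr : 0 ≤ r ^ 2 := by positivity
  have hRR : 0 ≤ R ^ 2 := by positivity
  generalize α ^ 4 * R ^ 6 = q at *
  generalize halfSq (toL2 V) = x at *
  generalize halfSq (opGL2 A (toL2 V)) = y at *
  have m1 := mul_le_mul_of_nonneg_left hr hJ10
  have m2 := mul_le_mul_of_nonneg_left hr hK1
  have m3 := mul_le_mul_of_nonneg_left hr hK4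
  have p1 := mul_nonneg hJ0 hRR
  have p2 := mul_nonneg hK2 hRR
  have p3 := mul_nonneg hK3 hRR
  have q1 := mul_nonneg hJ0 hq
  have q2 := mul_nonneg hJ10 hq
  have q3 := mul_nonneg hK1 hq
  have q4 := mul_nonneg hK2 hq
  have q5 := mul_nonneg hK4 hq
  have s1 := mul_nonneg hJ10 hY0
  have s2 := mul_nonneg hK1 hY0
  have s3 := mul_nonneg hK2 hY0
  have s4 := mul_nonneg hK3 hY0
  have t1 := mul_nonneg hJ0 hz
  have t2 := mul_nonneg hJ10 hz
  have t3 := mul_nonneg hK1 hz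
  have t4 := mul_nonneg hK3 hz
  have t5 := mul_nonneg hK4 hz
  linarith

/-! ### Weak derivatives in time. -/

/-- Smooth functions of time with compact support in `(0, T)`. -/
def IsTimeTest (T : ℝ) (η : ℝ → ℝ) : Prop :=
  ContDiff ℝ (⊤ : ℕ∞) η ∧ ∃ t₀ t₁ : ℝ, 0 < t₀ ∧ t₀ ≤ t₁ ∧ t₁ < T ∧ ∀ t ∉ Icc t₀ t₁, η t = 0

lemma eq_zero_of_le_of_ge {η : ℝ → ℝ} {t₀ t₁ : ℝ} (hη : Continuous η)
    (h : ∀ t ∉ Icc t₀ t₁, η t = 0) : η t₀ = 0 ∧ η t₁ = 0 := by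
  have hc : IsClosed {t | η t = 0} := isClosed_eq hη continuous_const
  constructor
  · have h1 : Iio t₀ ⊆ {t | η t = 0} := fun t ht => h t fun h' => not_lt.2 h'.1 ht
    have := hc.closure_subset_iff.2 h1
    rw [closure_Iio] at this
    exact this (mem_Iic.2 le_rfl)
  · have h1 : Ioi t₁ ⊆ {t | η t = 0} := fun t ht => h t fun h' => not_lt.2 h'.2 ht
    have := hc.closure_subset_iff.2 h1
    rw [closure_Ioi] at this
    exact this (mem_Ici.2 le_rfl)

lemma deriv_eq_zero_of_notMem {η : ℝ → ℝ} {t₀ t₁ : ℝ}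
    (h : ∀ t ∉ Icc t₀ t₁, η t = 0) {t : ℝ} (ht : t ∉ Icc t₀ t₁) : deriv η t = 0 := by
  have h1 : η =ᶠ[𝓝 t] fun _ => 0 := by
    filter_upwards [isClosed_Icc.isOpen_compl.mem_nhds ht] with s hs
    exact h s hs
  rw [h1.deriv_eq, deriv_const]

lemma setIntegral_Ioo_eq {f : ℝ → ℂ} {T t₀ t₁ : ℝ} (h0 : 0 < t₀) (h01 : t₀ ≤ t₁) (h1 : t₁ < T)
    (h : ∀ t ∉ Icc t₀ t₁, f t = 0) : ∫ t in Ioo 0 T, f t = ∫ t in t₀..t₁, f t := by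
  rw [intervalIntegral.integral_of_le h01, ← integral_Icc_eq_integral_Ioc]
  exact setIntegral_eq_of_subset_of_forall_sdiff_eq_zero measurableSet_Ioo
    (fun t ht => ⟨h0.trans_le ht.1, ht.2.trans_lt h1⟩) fun t ht => h t ht.2

lemma integrableOn_Ioo_of_support {f : ℝ → ℂ} {T t₀ t₁ : ℝ} (h0 : 0 < t₀)
    (h1 : t₁ < T) (hf : ContinuousOn f (Ioo 0 T)) (h : ∀ t ∉ Icc t₀ t₁, f t = 0) :
    IntegrableOn f (Ioo 0 T) := by
  have h2 : IntegrableOn f (Icc t₀ t₁) :=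
    (hf.mono fun t ht => ⟨h0.trans_le ht.1, ht.2.trans_lt h1⟩).integrableOn_compact isCompact_Icc
  exact h2.of_forall_sdiff_eq_zero measurableSet_Ioo fun t ht => h t ht.2

lemma exists_isTimeTest_integral_eq_one {T : ℝ} (hT : 0 < T) :
    ∃ η, IsTimeTest T η ∧ ∫ t in Ioo 0 T, η t = 1 := by
  let b : ContDiffBump (T / 2) := ⟨T / 8, T / 4, by positivity, by linarith⟩
  have hz : ∀ t ∉ Icc (T / 4) (3 * T / 4), b.normed volume t = 0 := fun t ht => by
    by_contra hne
    have h1 : t ∈ Function.support (b.normed volume) := hne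
    rw [b.support_normed_eq, Real.ball_eq_Ioo] at h1
    refine ht ⟨?_, ?_⟩
    · have := h1.1; change T / 2 - T / 4 < t at this; linarith
    · have := h1.2; change t < T / 2 + T / 4 at this; linarith
  refine ⟨b.normed volume, ⟨b.contDiff_normed, T / 4, 3 * T / 4, by positivity, by linarith,
    by linarith, hz⟩, ?_⟩
  rw [setIntegral_eq_integral_of_forall_compl_eq_zero, b.integral_normed]
  intro t ht
  refine hz t fun h => ht ⟨?_, ?_⟩
  · linarith [h.1]
  · linarith [h.2]

/-- The lemma of du Bois-Reymond. -/
lemma exists_eq_const_of_integral_mul_deriv_eq_zero {T : ℝ} (hT : 0 < T) {g : ℝ → ℂ}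
    (hg : ContinuousOn g (Ioo 0 T))
    (h : ∀ η, IsTimeTest T η → ∫ t in Ioo 0 T, g t * ((deriv η t : ℝ) : ℂ) = 0) :
    ∃ c : ℂ, ∀ t ∈ Ioo 0 T, g t = c := by
  obtain ⟨η₀, hη₀, hη₀1⟩ := exists_isTimeTest_integral_eq_one hT
  set c : ℂ := ∫ t in Ioo 0 T, g t * (η₀ t : ℂ) with hc
  -- For any `ψ`, the function `ψ - (∫ψ)η₀` has mean zero, so its primitive `θ` is again a test
  -- function and may be inserted in the hypothesis.
  have key : ∀ ψ, IsTimeTest T ψ → ∫ t in Ioo 0 T, (g t - c) * (ψ t : ℂ) = 0 := by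
    intro ψ hψ
    obtain ⟨hψs, t₀, t₁, h0, h01, h1, hψz⟩ := hψ
    obtain ⟨hηs, s₀, s₁, k0, k01, k1, hηz⟩ := hη₀
    set m : ℝ := ∫ t in Ioo 0 T, ψ t with hm
    set ρ : ℝ → ℝ := fun t => ψ t - m * η₀ t with hρ
    have hρs : ContDiff ℝ (⊤ : ℕ∞) ρ := hψs.sub (contDiff_const.mul hηs)
    set r₀ := min t₀ s₀
    set r₁ := max t₁ s₁
    have hr0 : 0 < r₀ := lt_min h0 k0
    have hr1 : r₁ < T := max_lt h1 k1
    have hr01 : r₀ ≤ r₁ := (min_le_left _ _).trans (h01.trans (le_max_left _ _))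
    have hsub1 : Icc t₀ t₁ ⊆ Icc r₀ r₁ := Icc_subset_Icc (min_le_left _ _) (le_max_left _ _)
    have hsub2 : Icc s₀ s₁ ⊆ Icc r₀ r₁ := Icc_subset_Icc (min_le_right _ _) (le_max_right _ _)
    have hψz' : ∀ t ∉ Icc r₀ r₁, ψ t = 0 := fun t ht => hψz t fun h => ht (hsub1 h)
    have hηz' : ∀ t ∉ Icc r₀ r₁, η₀ t = 0 := fun t ht => hηz t fun h => ht (hsub2 h)
    have hρz : ∀ t ∉ Icc r₀ r₁, ρ t = 0 := fun t ht => by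
      simp only [hρ, hψz' t ht, hηz' t ht, mul_zero, sub_zero]
    set θ : ℝ → ℝ := fun t => ∫ s in (0 : ℝ)..t, ρ s with hθ
    have hθd : ∀ t, HasDerivAt θ (ρ t) t := fun t =>
      intervalIntegral.integral_hasDerivAt_right (hρs.continuous.intervalIntegrable _ _)
        (hρs.continuous.stronglyMeasurableAtFilter _ _) hρs.continuous.continuousAt
    have hθd' : deriv θ = ρ := by ext t; exact (hθd t).deriv
    have hψi : IntegrableOn ψ (Ioo 0 T) :=
      hψs.continuous.integrableOn_Icc.mono_set Ioo_subset_Icc_self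
    have hηi : IntegrableOn η₀ (Ioo 0 T) :=
      hηs.continuous.integrableOn_Icc.mono_set Ioo_subset_Icc_self
    have hρint : ∫ t in Ioo 0 T, ρ t = 0 := by
      rw [hρ, integral_sub hψi (hηi.const_mul m), integral_const_mul, hη₀1, ← hm, mul_one, sub_self]
    have hρ0 : ∫ t in r₀..r₁, ρ t = 0 := by
      rw [← hρint, intervalIntegral.integral_of_le hr01, ← integral_Icc_eq_integral_Ioc]
      exact (setIntegral_eq_of_subset_of_forall_sdiff_eq_zero measurableSet_Ioo
        (fun t ht => ⟨hr0.trans_le ht.1, ht.2.trans_lt hr1⟩) fun t ht => hρz t ht.2).symm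
    have hvan : ∀ p q : ℝ, (∀ s ∈ uIcc p q, ρ s = 0) → ∫ s in p..q, ρ s = 0 := fun p q hpq => by
      rw [intervalIntegral.integral_congr (g := fun _ => (0 : ℝ)) fun s hs => hpq s hs]
      simp
    have hρe := eq_zero_of_le_of_ge hρs.continuous hρz
    have hii : ∀ p q, IntervalIntegrable ρ volume p q := fun p q =>
      hρs.continuous.intervalIntegrable _ _
    have hleft : ∀ t ≤ r₀, ρ t = 0 := fun t ht => by
      rcases ht.lt_or_eq with h | h
      · exact hρz t fun h' => not_lt.2 h'.1 h
      · rw [h]; exact hρe.1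
    have hright : ∀ t, r₁ ≤ t → ρ t = 0 := fun t ht => by
      rcases ht.lt_or_eq with h | h
      · exact hρz t fun h' => not_lt.2 h'.2 h
      · rw [← h]; exact hρe.2
    have hθ0 : θ r₀ = 0 := hvan _ _ fun s hs => by
      rw [uIcc_of_le hr0.le] at hs
      exact hleft s hs.2
    have hθ1 : θ r₁ = 0 := by
      have := intervalIntegral.integral_add_adjacent_intervals (hii 0 r₀) (hii r₀ r₁)
      rw [hρ0, add_zero] at this
      exact this.symm.trans hθ0
    have hθz : ∀ t ∉ Icc r₀ r₁, θ t = 0 := fun t ht => by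
      rw [mem_Icc, not_and_or, not_le, not_le] at ht
      rcases ht with ht | ht
      · have := intervalIntegral.integral_add_adjacent_intervals (hii 0 t) (hii t r₀)
        rw [hvan t r₀ fun s hs => by
          rw [uIcc_of_le ht.le] at hs
          exact hleft s hs.2, add_zero] at this
        exact this.trans hθ0
      · have := intervalIntegral.integral_add_adjacent_intervals (hii 0 r₁) (hii r₁ t)
        rw [hvan r₁ t fun s hs => by
          rw [uIcc_of_le ht.le] at hs
          exact hright s hs.1, add_zero] at this
        exact this.symm.trans hθ1
    have hθs : ContDiff ℝ (⊤ : ℕ∞) θ := by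
      rw [contDiff_infty_iff_deriv, hθd']
      exact ⟨fun t => (hθd t).differentiableAt, hρs⟩
    have hfin := h θ ⟨hθs, r₀, r₁, hr0, hr01, hr1, hθz⟩
    rw [hθd'] at hfin
    have i1 : IntegrableOn (fun t => g t * (ψ t : ℂ)) (Ioo 0 T) :=
      integrableOn_Ioo_of_support hr0 hr1
        (hg.mul (Complex.continuous_ofReal.comp hψs.continuous).continuousOn)
        fun t ht => by rw [hψz' t ht, Complex.ofReal_zero, mul_zero]
    have i2 : IntegrableOn (fun t => g t * (η₀ t : ℂ)) (Ioo 0 T) :=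
      integrableOn_Ioo_of_support hr0 hr1
        (hg.mul (Complex.continuous_ofReal.comp hηs.continuous).continuousOn)
        fun t ht => by rw [hηz' t ht, Complex.ofReal_zero, mul_zero]
    have i3 : IntegrableOn (fun t => (ψ t : ℂ)) (Ioo 0 T) := hψi.ofReal
    have e1 : ∫ t in Ioo 0 T, g t * (ρ t : ℂ)
        = (∫ t in Ioo 0 T, g t * (ψ t : ℂ)) - m * c := by
      rw [hc, ← integral_const_mul, ← integral_sub i1 (i2.const_mul _)]
      congr 1
      ext t
      simp only [hρ]
      push_cast
      ring
    have e2 : ∫ t in Ioo 0 T, (g t - c) * (ψ t : ℂ)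
        = (∫ t in Ioo 0 T, g t * (ψ t : ℂ)) - c * m := by
      rw [hm, ← integral_complex_ofReal, ← integral_const_mul, ← integral_sub i1 (i3.const_mul _)]
      congr 1
      ext t
      ring
    rw [e2, mul_comm c, ← e1, hfin]
  refine ⟨c, ?_⟩
  have hgc : ContinuousOn (fun t => g t - c) (Ioo 0 T) := hg.sub continuousOn_const
  have hae := isOpen_Ioo.ae_eq_zero_of_integral_contDiff_smul_eq_zero (μ := volume)
    (hgc.locallyIntegrableOn measurableSet_Ioo) (fun ψ hψs hψc hψt => by
      have hψz : ∀ t ∉ Ioo 0 T, ψ t = 0 := fun t ht =>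
        image_eq_zero_of_notMem_tsupport fun h' => ht (hψt h')
      have hk : IsTimeTest T ψ := by
        refine ⟨hψs, ?_⟩
        rcases (tsupport ψ).eq_empty_or_nonempty with he | hne
        · refine ⟨T / 2, T / 2, by positivity, le_rfl, by linarith, fun t _ => ?_⟩
          exact image_eq_zero_of_notMem_tsupport (by rw [he]; exact Set.notMem_empty t)
        · obtain ⟨p, hp, hp'⟩ := hψc.isCompact.exists_isLeast hne
          obtain ⟨q, hq, hq'⟩ := hψc.isCompact.exists_isGreatest hne
          refine ⟨p, q, (hψt hp).1, hp' hq, (hψt hq).2, fun t ht => ?_⟩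
          exact image_eq_zero_of_notMem_tsupport fun h' => ht ⟨hp' h', hq' h'⟩
      rw [← key ψ hk, setIntegral_eq_integral_of_forall_compl_eq_zero]
      · congr 1
        ext t
        rw [Complex.real_smul, mul_comm]
      · intro t ht
        rw [hψz t ht, Complex.ofReal_zero, mul_zero])
  have hae' : (fun t => g t - c) =ᵐ[volume.restrict (Ioo 0 T)] fun _ => 0 := by
    rw [Filter.EventuallyEq, ae_restrict_iff' measurableSet_Ioo]
    exact hae
  intro t ht
  exact sub_eq_zero.1 (Measure.eqOn_open_of_ae_eq hae' isOpen_Ioo hgc continuousOn_const ht)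

/-- A continuous function with continuous weak derivative is the integral of this derivative. -/
lemma sub_eq_integral_of_weak_deriv {T : ℝ} {p q : ℝ → ℂ}
    (hp : ContinuousOn p (Ioo 0 T)) (hq : ContinuousOn q (Ioo 0 T))
    (h : ∀ η, IsTimeTest T η →
      ∫ t in Ioo 0 T, (p t * ((deriv η t : ℝ) : ℂ) + q t * (η t : ℂ)) = 0)
    {s t : ℝ} (hs : s ∈ Ioo 0 T) (ht : t ∈ Ioo 0 T) : p t - p s = ∫ r in s..t, q r := by
  have hT : 0 < T := hs.1.trans hs.2
  set Q : ℝ → ℂ := fun t => ∫ r in s..t, q r with hQ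
  have hQd : ∀ r ∈ Ioo 0 T, HasDerivAt Q (q r) r := fun r hr => by
    have hsub : uIcc s r ⊆ Ioo 0 T := (ordConnected_Ioo.uIcc_subset hs hr)
    exact intervalIntegral.integral_hasDerivAt_right (hq.mono hsub).intervalIntegrable
      (hq.stronglyMeasurableAtFilter isOpen_Ioo r hr) (hq.continuousAt (isOpen_Ioo.mem_nhds hr))
  have hQc : ContinuousOn Q (Ioo 0 T) := fun r hr => (hQd r hr).continuousAt.continuousWithinAt
  -- With `Q` the primitive of `q` from `s`, the difference `p - Q` has zero weak derivative, hence
  -- is constant.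
  obtain ⟨c, hc⟩ := exists_eq_const_of_integral_mul_deriv_eq_zero hT (hp.sub hQc) fun η hη => by
    have h1 := h η hη
    obtain ⟨hηs, t₀, t₁, h0, h01, h1', hz⟩ := hη
    have hdz : ∀ r ∉ Icc t₀ t₁, deriv η r = 0 := fun r hr => deriv_eq_zero_of_notMem hz hr
    have hηc : ContinuousOn (fun r => (η r : ℂ)) (Ioo 0 T) :=
      (Complex.continuous_ofReal.comp hηs.continuous).continuousOn
    have hdc : ContinuousOn (fun r => ((deriv η r : ℝ) : ℂ)) (Ioo 0 T) :=
      (Complex.continuous_ofReal.comp (hηs.continuous_deriv (by norm_num))).continuousOn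
    have i1 : IntegrableOn (fun r => p r * ((deriv η r : ℝ) : ℂ) + q r * (η r : ℂ)) (Ioo 0 T) :=
      integrableOn_Ioo_of_support h0 h1' ((hp.mul hdc).add (hq.mul hηc)) fun r hr => by
        simp [hz r hr, hdz r hr]
    have hc2 : ContinuousOn (fun r => q r * (η r : ℂ) + Q r * ((deriv η r : ℝ) : ℂ)) (Ioo 0 T) :=
      (hq.mul hηc).add (hQc.mul hdc)
    have i2 : IntegrableOn (fun r => q r * (η r : ℂ) + Q r * ((deriv η r : ℝ) : ℂ)) (Ioo 0 T) :=
      integrableOn_Ioo_of_support h0 h1' hc2 fun r hr => by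
        simp [hz r hr, hdz r hr]
    have h2 : ∫ r in Ioo 0 T, (q r * (η r : ℂ) + Q r * ((deriv η r : ℝ) : ℂ)) = 0 := by
      have hsub : uIcc t₀ t₁ ⊆ Ioo 0 T := by
        rw [uIcc_of_le h01]
        exact fun r hr => ⟨h0.trans_le hr.1, hr.2.trans_lt h1'⟩
      rw [setIntegral_Ioo_eq h0 h01 h1' fun r hr => by simp [hz r hr, hdz r hr],
        intervalIntegral.integral_eq_sub_of_hasDerivAt (f := fun r => Q r * (η r : ℂ))
          (fun r hr => (hQd r (hsub hr)).mul
            ((hηs.differentiable (by norm_num) r).hasDerivAt.ofReal_comp))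
          (hc2.mono hsub).intervalIntegrable]
      obtain ⟨z0, z1⟩ := eq_zero_of_le_of_ge hηs.continuous hz
      simp [z0, z1]
    have h3 := integral_sub i1 i2
    rw [h1, h2, sub_zero] at h3
    rw [← h3]
    congr 1
    ext r
    simp only [Pi.sub_apply]
    ring
  have e1 := hc t ht
  have e2 := hc s hs
  have hQs : Q s = 0 := intervalIntegral.integral_same
  simp only [Pi.sub_apply, hQs, sub_zero] at e1 e2
  rw [e2, ← e1]
  ring

/-! ### Trajectories in `H²` through `(1 - ∂²)⁻¹`. -/

/-- The symbol `(1 + k²)⁻¹`. -/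
def besselSymbol (k : ℤ) : ℂ := (((1 + (k : ℝ) ^ 2)⁻¹ : ℝ) : ℂ)

lemma norm_besselSymbol (k : ℤ) : ‖besselSymbol k‖ = (1 + (k : ℝ) ^ 2)⁻¹ := by
  rw [besselSymbol, Complex.norm_real, Real.norm_of_nonneg (by positivity)]

lemma besselSymbol_mul (k : ℤ) : besselSymbol k * (1 + (k : ℂ) ^ 2) = 1 := by
  have h : (1 + (k : ℂ) ^ 2) = ((1 + (k : ℝ) ^ 2 : ℝ) : ℂ) := by push_cast; rfl
  have h0 : (1 + (k : ℝ) ^ 2) ≠ 0 := by positivity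
  rw [besselSymbol, h, ← Complex.ofReal_mul, inv_mul_cancel₀ h0, Complex.ofReal_one]

lemma summable_besselSymbol : Summable fun k => ‖besselSymbol k‖ ^ 2 := by
  refine summable_inv_one_add_sq.of_nonneg_of_le (fun k => by positivity) fun k => ?_
  rw [norm_besselSymbol, sq]
  exact mul_le_of_le_one_left (by positivity)
    (inv_le_one_of_one_le₀ (by nlinarith [sq_nonneg (k : ℝ)]))

lemma summable_deriv_besselSymbol :
    Summable fun k : ℤ => ‖Complex.I * k * besselSymbol k‖ ^ 2 := by
  refine summable_inv_one_add_sq.of_nonneg_of_le (fun k => by positivity) fun k => ?_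
  rw [norm_mul, norm_mul, Complex.norm_I, one_mul, Complex.norm_intCast, norm_besselSymbol, mul_pow,
    sq_abs, inv_pow, ← div_eq_mul_inv, ← one_div, div_le_div_iff₀ (by positivity) (by positivity)]
  nlinarith [sq_nonneg (k : ℝ)]

lemma norm_deriv_two_besselSymbol_le (k : ℤ) :
    ‖Complex.I * k * (Complex.I * k * besselSymbol k)‖ ≤ 1 := by
  simp only [norm_mul, Complex.norm_I, one_mul, Complex.norm_intCast, norm_besselSymbol]
  rw [← mul_assoc, abs_mul_abs_self, ← div_eq_mul_inv, div_le_one (by positivity)]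
  nlinarith [sq_nonneg (k : ℝ)]

/-- The operator `(1 - ∂²)⁻¹`. -/
def bessel : L2 →L[ℂ] C(Torus, ℂ) := synth besselSymbol summable_besselSymbol

/-- The operator `∂ (1 - ∂²)⁻¹`. -/
def besselDeriv : L2 →L[ℂ] C(Torus, ℂ) := synth _ summable_deriv_besselSymbol

/-- The operator `∂² (1 - ∂²)⁻¹`. -/
def besselDerivTwo : L2 →L[ℂ] L2 := multiplier _ 1 norm_deriv_two_besselSymbol_le

lemma toL2_bessel {u w : L2} (h : ∀ k : ℤ, coef k w = (1 + (k : ℂ) ^ 2) * coef k u) :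
    toL2 (bessel w) = u := by
  refine ext_coef fun k => ?_
  rw [bessel, coef_toL2_synth, h, ← mul_assoc, besselSymbol_mul, one_mul]

/-- With `w = (1 - ∂²)u`, the function and its two derivatives are bounded operators applied to the
single element `w` of `L²`; continuity in time of every term of the equation then reduces to that of
`w`. -/
lemma isH2_bessel {u w : L2} (hu : MemH00 u)
    (h : ∀ k : ℤ, coef k w = (1 + (k : ℂ) ^ 2) * coef k u) :
    IsH2 (bessel w) (besselDeriv w) (besselDerivTwo w) where
  hasSum := by
    convert! hasSum_synth summable_besselSymbol w using 1
    ext1 k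
    rw [bessel, coef_toL2_synth]
  deriv := hasTorusDeriv_synth summable_besselSymbol summable_deriv_besselSymbol w
  star_eq := by
    refine toL2_injective (Lp.ext ?_)
    have h1 := coeFn_toL2 (bessel w)
    filter_upwards [h1, coeFn_toL2 (star (bessel w)), hu.1] with x e1 e2 e3
    rw [toL2_bessel h] at e1 ⊢
    rw [e2, ContinuousMap.star_apply, ← e1]
    exact Complex.conj_eq_iff_im.2 e3
  mean := by
    rw [toL2_bessel h, coef_eq_fourierCoeff]
    exact hu.2
  coef_two k := by
    rw [besselDerivTwo, coef_multiplier, besselDeriv, coef_toL2_synth]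
    ring

lemma sobolevSq_two_eq {u w : L2} (h : ∀ k : ℤ, coef k w = (1 + (k : ℂ) ^ 2) * coef k u) :
    sobolevSq 2 u = ENNReal.ofReal (‖w‖ ^ 2) := by
  have h1 : ∀ k : ℤ, (1 + (k : ℝ) ^ 2) ^ (2 : ℝ) * ‖fourierCoeff (⇑u) k‖ ^ 2 = ‖coef k w‖ ^ 2 := by
    intro k
    have h2 : (1 + (k : ℂ) ^ 2) = ((1 + (k : ℝ) ^ 2 : ℝ) : ℂ) := by push_cast; rfl
    rw [h, norm_mul, mul_pow, coef_eq_fourierCoeff, h2, Complex.norm_real,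
      Real.norm_of_nonneg (by positivity), Real.rpow_two]
  simp only [sobolevSq, h1]
  rw [← ENNReal.ofReal_tsum_of_nonneg (fun k => by positivity) (summable_sq_coef w),
    ← ENNReal.ofReal_mul Real.two_pi_pos.le, ← norm_sq_eq_tsum]

lemma exists_of_sobolevSq_two_lt_top {u : L2} (h : sobolevSq 2 u < ⊤) :
    ∃ w : L2, ∀ k : ℤ, coef k w = (1 + (k : ℂ) ^ 2) * coef k u := by
  refine exists_coef_eq ?_
  have h1 : ∑' k : ℤ, ENNReal.ofReal ((1 + (k : ℝ) ^ 2) ^ (2 : ℝ) * ‖fourierCoeff (⇑u) k‖ ^ 2)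
      ≠ ⊤ := by
    intro ht
    rw [sobolevSq, ht, ENNReal.mul_top (by simpa using Real.pi_pos)] at h
    exact lt_irrefl _ h
  refine (ENNReal.summable_toReal h1).congr fun k => ?_
  have h2 : (1 + (k : ℂ) ^ 2) = ((1 + (k : ℝ) ^ 2 : ℝ) : ℂ) := by push_cast; rfl
  rw [ENNReal.toReal_ofReal (by positivity), norm_mul, mul_pow, coef_eq_fourierCoeff, h2,
    Complex.norm_real, Real.norm_of_nonneg (by positivity), Real.rpow_two]

/-- A continuous trajectory in `H²(𝕋)` is the image of one in `L²(𝕋)` under `(1 - ∂²)⁻¹`. -/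
lemma exists_continuousOn_of_continuousInSobolev {v : ℝ → L2} {J : Set ℝ}
    (h : ContinuousInSobolev 2 v J) :
    ∃ w : ℝ → L2, ContinuousOn w J ∧
      ∀ t ∈ J, ∀ k : ℤ, coef k (w t) = (1 + (k : ℂ) ^ 2) * coef k (v t) := by
  have h1 : ∀ t, ∃ w : L2, t ∈ J → ∀ k : ℤ, coef k w = (1 + (k : ℂ) ^ 2) * coef k (v t) := by
    intro t
    by_cases ht : t ∈ J
    · obtain ⟨w, hw⟩ := exists_of_sobolevSq_two_lt_top (h.1 t ht)
      exact ⟨w, fun _ => hw⟩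
    · exact ⟨0, fun h' => absurd h' ht⟩
  choose w hw using h1
  refine ⟨w, fun t₀ ht₀ => ?_, hw⟩
  have h2 : Tendsto (fun t => ENNReal.ofReal (‖w t - w t₀‖ ^ 2)) (𝓝[J] t₀) (𝓝 0) := by
    refine (h.2 t₀ ht₀).congr' ?_
    filter_upwards [self_mem_nhdsWithin] with t ht
    refine sobolevSq_two_eq fun k => ?_
    rw [map_sub, map_sub, hw t ht, hw t₀ ht₀, mul_sub]
  have h3 := (ENNReal.tendsto_toReal ENNReal.zero_ne_top).comp h2
  have h4 : Tendsto (fun t => ‖w t - w t₀‖ ^ 2) (𝓝[J] t₀) (𝓝 0) := by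
    refine h3.congr fun t => ?_
    exact ENNReal.toReal_ofReal (by positivity)
  have h5 := h4.sqrt
  simp only [Real.sqrt_sq (norm_nonneg _), Real.sqrt_zero] at h5
  exact tendsto_iff_norm_sub_tendsto_zero.2 h5

lemma continuous_timeDeriv (A A1 : C(Torus, ℂ)) (ε α : ℝ) :
    Continuous fun w : L2 => timeDeriv A A1 ε α (bessel w) (besselDeriv w) (besselDerivTwo w) := by
  unfold timeDeriv derivG
  fun_prop

/-! ### From the distributional equation to a classical time derivative. -/

section WeakFormulation

variable {V V1 : C(Torus, ℂ)} {u2 : L2}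

lemma dx_eq (h : IsH2 V V1 u2) : dx (toL2 V) = toL2 V1 :=
  fourierMul_eq fun k => by rw [h.deriv.coef_eq, coef_eq_fourierCoeff]

lemma dx_dx_eq (h : IsH2 V V1 u2) : dx (dx (toL2 V)) = u2 := by
  rw [dx_eq h]
  exact fourierMul_eq fun k => by rw [h.coef_two, coef_eq_fourierCoeff]

lemma hilbert_eq (f : L2) : hilbert f = hilbL2 f :=
  fourierMul_eq fun k => by rw [coef_hilbL2, coef_eq_fourierCoeff]

lemma opG_ae_eq {a : Torus → ℝ} (ha : SmoothTorus a) (f : L2) :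
    opG a f =ᵐ[volume] opGL2 (smoothC a ha) f := by
  have hc : inner ℂ (toL2 (smoothC a ha)) f = ∫ y, (a y : ℂ) * f y := by
    rw [inner_toL2]
    simp
  rw [opGL2_apply]
  filter_upwards [Lp.coeFn_sub (mulL2 (smoothC a ha) f)
      ((inner ℂ (toL2 (smoothC a ha)) f : ℂ) • toL2 (smoothC a ha)),
    Lp.coeFn_smul (inner ℂ (toL2 (smoothC a ha)) f : ℂ) (toL2 (smoothC a ha)),
    coeFn_mulL2 (smoothC a ha) f, coeFn_toL2 (smoothC a ha)] with x h1 h2 h3 h4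
  rw [h1, Pi.sub_apply, h2, Pi.smul_apply, h3, h4, hc, opG, smoothC_apply, smul_eq_mul]
  ring

lemma Dpow_one_opG_eq {a : Torus → ℝ} (ha : SmoothTorus a) {A1 : C(Torus, ℂ)}
    (hA1 : HasTorusDeriv (smoothC a ha) A1) (h : IsH2 V V1 u2) :
    Dpow 1 (opG a (toL2 V)) = hilbL2 (toL2 (derivG (smoothC a ha) A1 V V1)) := by
  refine fourierMul_eq fun k => ?_
  rw [coef_opGL2_deriv hA1 h.deriv, Real.rpow_one, coef_eq_fourierCoeff,
    fourierCoeff_congr_volume (opG_ae_eq ha _)]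

lemma integrable_coe_L2 (f : L2) : Integrable (fun x => f x) volume :=
  (Lp.memLp f).integrable (by norm_num)

lemma inner_smoothC {ψ : Torus → ℝ} (hψ : SmoothTorus ψ) (f : L2) :
    inner ℂ (toL2 (smoothC ψ hψ)) f = ∫ x, f x * (ψ x : ℂ) := by
  rw [inner_toL2]
  simp [mul_comm]

lemma integrable_mul_smooth {ψ : Torus → ℝ} (hψ : SmoothTorus ψ) (f : L2) :
    Integrable (fun x => f x * (ψ x : ℂ)) volume := by
  refine (integrable_coe_L2 (mulL2 (smoothC ψ hψ) f)).congr ?_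
  filter_upwards [coeFn_mulL2 (smoothC ψ hψ) f] with x hx
  rw [hx, smoothC_apply, mul_comm]

/-- The spatial integrals in the weak formulation, for a test function `η(t) ψ(x)`. -/
lemma weak_left_eq {ψ : Torus → ℝ} (hψ : SmoothTorus ψ) (h : IsH2 V V1 u2) (ε α d e : ℝ) :
    (∫ x : Torus, (-(toL2 V x) * ((d * ψ x : ℝ) : ℂ)
        + (hilbert (dx (dx (toL2 V))) x - (ε : ℂ) * dx (dx (toL2 V)) x
            + (α : ℂ) * (toL2 V x * dx (toL2 V) x)) * ((e * ψ x : ℝ) : ℂ)))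
      = -(inner ℂ (toL2 (smoothC ψ hψ)) (toL2 V) * d)
        + inner ℂ (toL2 (smoothC ψ hψ)) (hilbL2 u2 - (ε : ℂ) • u2 + (α : ℂ) • toL2 (V * V1)) * e := by
  rw [dx_dx_eq h, dx_eq h, hilbert_eq, inner_smoothC, inner_smoothC]
  set g := hilbL2 u2 - (ε : ℂ) • u2 + (α : ℂ) • toL2 (V * V1) with hg
  have i1 : Integrable (fun x => -(toL2 V x * (ψ x : ℂ) * (d : ℂ))) volume :=
    ((integrable_mul_smooth hψ _).mul_const _).neg
  have i2 : Integrable (fun x => g x * (ψ x : ℂ) * (e : ℂ)) volume :=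
    (integrable_mul_smooth hψ _).mul_const _
  rw [← integral_mul_const, ← integral_mul_const, ← integral_neg, ← integral_add i1 i2]
  refine integral_congr_ae ?_
  filter_upwards [Lp.coeFn_add (hilbL2 u2 - (ε : ℂ) • u2) ((α : ℂ) • toL2 (V * V1)),
    Lp.coeFn_sub (hilbL2 u2) ((ε : ℂ) • u2), Lp.coeFn_smul (ε : ℂ) u2,
    Lp.coeFn_smul (α : ℂ) (toL2 (V * V1)), coeFn_toL2 (V * V1), coeFn_toL2 V,
    coeFn_toL2 V1] with x h1 h2 h3 h4 h5 h6 h7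
  rw [hg, h1, Pi.add_apply, h2, Pi.sub_apply, h3, h4, Pi.smul_apply, Pi.smul_apply, h5, h6, h7,
    ContinuousMap.mul_apply, smul_eq_mul, smul_eq_mul]
  push_cast
  ring

lemma weak_right_eq {a : Torus → ℝ} (ha : SmoothTorus a) {A1 : C(Torus, ℂ)}
    (hA1 : HasTorusDeriv (smoothC a ha) A1) {ψ : Torus → ℝ} (hψ : SmoothTorus ψ)
    (h : IsH2 V V1 u2) (e : ℝ) :
    (∫ x : Torus, -(opG a (Dpow 1 (opG a (toL2 V))) x) * ((e * ψ x : ℝ) : ℂ))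
      = -(inner ℂ (toL2 (smoothC ψ hψ))
          (opGL2 (smoothC a ha) (hilbL2 (toL2 (derivG (smoothC a ha) A1 V V1)))) * e) := by
  rw [Dpow_one_opG_eq ha hA1 h, inner_smoothC, ← integral_mul_const, ← integral_neg]
  refine integral_congr_ae ?_
  filter_upwards [opG_ae_eq ha (hilbL2 (toL2 (derivG (smoothC a ha) A1 V V1)))] with x hx
  rw [hx]
  push_cast
  ring

end WeakFormulation

/-- The time derivative that the equation prescribes for the trajectory `(1 - ∂²)⁻¹ w`. -/
def trajDeriv (A A1 : C(Torus, ℂ)) (ε α : ℝ) (w : L2) : L2 :=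
  timeDeriv A A1 ε α (bessel w) (besselDeriv w) (besselDerivTwo w)

lemma isTestFunction_mul {T : ℝ} {η : ℝ → ℝ} (hη : IsTimeTest T η) {ψ : Torus → ℝ}
    (hψ : SmoothTorus ψ) : IsTestFunction T fun t x => η t * ψ x := by
  obtain ⟨hs, t₀, t₁, h0, -, h1, hz⟩ := hη
  refine ⟨?_, t₀, t₁, h0, h1, fun t ht x => by rw [hz t ht, zero_mul]⟩
  exact (hs.comp contDiff_fst).mul (ContDiff.comp (g := fun x : ℝ => ψ (x : Torus)) hψ contDiff_snd)

section Trajectory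

variable {a : Torus → ℝ} {A1 : C(Torus, ℂ)} {ε α T : ℝ} {v w : ℝ → L2}

/-- Testing with `η(t)ψ(x)` says that `t ↦ (ψ, v(t))` has the continuous weak derivative `(ψ,
F(t))`, where `F` is the prescribed time derivative. -/
lemma inner_smooth_sub_eq_integral (ha : SmoothTorus a) (hA1 : HasTorusDeriv (smoothC a ha) A1)
    (hv : Regular T v) (hsol : SolvesDampedBO a ε α T v) (hwc : ContinuousOn w (Ioc 0 T))
    (hw : ∀ t ∈ Ioc 0 T, ∀ k : ℤ, coef k (w t) = (1 + (k : ℂ) ^ 2) * coef k (v t))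
    {ψ : Torus → ℝ} (hψ : SmoothTorus ψ) {s t : ℝ} (hs : s ∈ Ioo 0 T) (ht : t ∈ Ioo 0 T) :
    inner ℂ (toL2 (smoothC ψ hψ)) (v t) - inner ℂ (toL2 (smoothC ψ hψ)) (v s)
      = ∫ r in s..t, inner ℂ (toL2 (smoothC ψ hψ)) (trajDeriv (smoothC a ha) A1 ε α (w r)) := by
  set P := innerSL ℂ (toL2 (smoothC ψ hψ)) with hP
  have hwo : ContinuousOn w (Ioo 0 T) := hwc.mono Ioo_subset_Ioc_self
  have hp : ContinuousOn (fun t => P (v t)) (Ioo 0 T) :=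
    P.continuous.comp_continuousOn (hv.continuousOn.mono Ioo_subset_Icc_self)
  have hq : ContinuousOn (fun t => P (trajDeriv (smoothC a ha) A1 ε α (w t))) (Ioo 0 T) :=
    (P.continuous.comp (continuous_timeDeriv _ _ _ _)).comp_continuousOn hwo
  have hq2 : ContinuousOn (fun t => P (opGL2 (smoothC a ha) (hilbL2 (toL2
      (derivG (smoothC a ha) A1 (bessel (w t)) (besselDeriv (w t))))))) (Ioo 0 T) := by
    refine Continuous.comp_continuousOn (g := fun u : L2 => P (opGL2 (smoothC a ha) (hilbL2 (toL2
      (derivG (smoothC a ha) A1 (bessel u) (besselDeriv u)))))) ?_ hwo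
    unfold derivG
    fun_prop
  refine sub_eq_integral_of_weak_deriv hp hq (fun η hη => ?_) hs ht
  have h := hsol _ (isTestFunction_mul hη hψ)
  obtain ⟨hηs, t₀, t₁, h0, h01, h1, hz⟩ := hη
  have hdz : ∀ r ∉ Icc t₀ t₁, deriv η r = 0 := fun r hr => deriv_eq_zero_of_notMem hz hr
  have hηc : ContinuousOn (fun r => (η r : ℂ)) (Ioo 0 T) :=
    (Complex.continuous_ofReal.comp hηs.continuous).continuousOn
  have hdc : ContinuousOn (fun r => ((deriv η r : ℝ) : ℂ)) (Ioo 0 T) :=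
    (Complex.continuous_ofReal.comp (hηs.continuous_deriv (by norm_num))).continuousOn
  set q : ℝ → ℂ := fun t => P (trajDeriv (smoothC a ha) A1 ε α (w t)) with hqd
  set q2 : ℝ → ℂ := fun t => P (opGL2 (smoothC a ha) (hilbL2 (toL2
      (derivG (smoothC a ha) A1 (bessel (w t)) (besselDeriv (w t)))))) with hq2d
  -- The damping `q2` is part of `q` but stands on the right of the equation, so the spatial terms
  -- on the left are `-q - q2`; the two copies cancel at the end.
  have hL : ∫ t in Ioo 0 T, (-(P (v t) * ((deriv η t : ℝ) : ℂ)) + (-q t - q2 t) * (η t : ℂ))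
      = ∫ t in Ioo 0 T, -(q2 t * (η t : ℂ)) := by
    refine Eq.trans (setIntegral_congr_fun measurableSet_Ioo fun t ht => ?_)
      (h.trans (setIntegral_congr_fun measurableSet_Ioo fun t ht => ?_))
    · have hH := isH2_bessel (hv.memH00 t (Ioo_subset_Icc_self ht)) (hw t (Ioo_subset_Ioc_self ht))
      have hd : ∀ x, deriv (fun s => η s * ψ x) t = deriv η t * ψ x := fun x =>
        deriv_mul_const_field _
      have e := weak_left_eq hψ hH ε α (deriv η t) (η t)
      rw [toL2_bessel (hw t (Ioo_subset_Ioc_self ht))] at e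
      simp only [hd]
      refine Eq.trans ?_ e.symm
      congr 2
      have e2 : hilbL2 (besselDerivTwo (w t)) - (ε : ℂ) • besselDerivTwo (w t)
          + (α : ℂ) • toL2 (bessel (w t) * besselDeriv (w t))
          = -trajDeriv (smoothC a ha) A1 ε α (w t) - opGL2 (smoothC a ha) (hilbL2 (toL2
            (derivG (smoothC a ha) A1 (bessel (w t)) (besselDeriv (w t))))) := by
        rw [trajDeriv, timeDeriv]
        abel
      rw [e2, inner_sub_right, inner_neg_right]
      rfl
    · have hH := isH2_bessel (hv.memH00 t (Ioo_subset_Icc_self ht)) (hw t (Ioo_subset_Ioc_self ht))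
      have e := weak_right_eq ha hA1 hψ hH (η t)
      rw [toL2_bessel (hw t (Ioo_subset_Ioc_self ht))] at e
      exact e
  have i1 : IntegrableOn (fun t => -(P (v t) * ((deriv η t : ℝ) : ℂ)) + (-q t - q2 t) * (η t : ℂ))
      (Ioo 0 T) :=
    integrableOn_Ioo_of_support h0 h1 ((hp.mul hdc).neg.add ((hq.neg.sub hq2).mul hηc))
      fun r hr => by simp [hz r hr, hdz r hr]
  have i2 : IntegrableOn (fun t => -(q2 t * (η t : ℂ))) (Ioo 0 T) :=
    integrableOn_Ioo_of_support h0 h1 (hq2.mul hηc).neg fun r hr => by simp [hz r hr]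
  have h3 := integral_sub i2 i1
  rw [hL, sub_self] at h3
  rw [← h3]
  congr 1
  ext t
  ring

lemma smoothTorus_fourier_re (k : ℤ) : SmoothTorus fun x => (fourier k x : ℂ).re := by
  unfold SmoothTorus
  simp only [fourier_coe_apply]
  refine Complex.reCLM.contDiff.comp (Complex.contDiff_exp.comp ?_)
  exact ((contDiff_const.mul Complex.ofRealCLM.contDiff)).div_const _

lemma smoothTorus_fourier_im (k : ℤ) : SmoothTorus fun x => (fourier k x : ℂ).im := by
  unfold SmoothTorus
  simp only [fourier_coe_apply]
  refine Complex.imCLM.contDiff.comp (Complex.contDiff_exp.comp ?_)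
  exact ((contDiff_const.mul Complex.ofRealCLM.contDiff)).div_const _

/-- Test functions are real, so Fourier coefficients are reached through real and imaginary parts of
exponentials. -/
lemma expL2_eq_re_add_im (k : ℤ) :
    expL2 k = toL2 (smoothC _ (smoothTorus_fourier_re k))
      + Complex.I • toL2 (smoothC _ (smoothTorus_fourier_im k)) := by
  rw [expL2_eq_toL2, ← map_smul, ← map_add]
  congr 1
  ext x
  simp only [ContinuousMap.add_apply, ContinuousMap.smul_apply, smoothC_apply, smul_eq_mul]
  rw [mul_comm Complex.I]
  exact (Complex.re_add_im _).symm

/-- The scalar identities for all Fourier coefficients amount to `v(s) = v(t) + ∫ F` in `L²`, and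
`F` is continuous. -/
lemma hasDerivAt_trajectory (ha : SmoothTorus a) (hA1 : HasTorusDeriv (smoothC a ha) A1)
    (hv : Regular T v) (hsol : SolvesDampedBO a ε α T v) (hwc : ContinuousOn w (Ioc 0 T))
    (hw : ∀ t ∈ Ioc 0 T, ∀ k : ℤ, coef k (w t) = (1 + (k : ℂ) ^ 2) * coef k (v t))
    {t : ℝ} (ht : t ∈ Ioo 0 T) :
    HasDerivAt v (trajDeriv (smoothC a ha) A1 ε α (w t)) t := by
  set F : ℝ → L2 := fun t => trajDeriv (smoothC a ha) A1 ε α (w t) with hF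
  have hFc : ContinuousOn F (Ioo 0 T) :=
    (continuous_timeDeriv _ _ _ _).comp_continuousOn (hwc.mono Ioo_subset_Ioc_self)
  have key : ∀ s ∈ Ioo 0 T, v s = v t + ∫ r in t..s, F r := fun s hs => by
    have hsub : uIcc t s ⊆ Ioo 0 T := ordConnected_Ioo.uIcc_subset ht hs
    have hFi : IntervalIntegrable F volume t s := (hFc.mono hsub).intervalIntegrable
    refine ext_coef fun k => ?_
    have h1 := inner_smooth_sub_eq_integral ha hA1 hv hsol hwc hw (smoothTorus_fourier_re k) ht hs
    have h2 := inner_smooth_sub_eq_integral ha hA1 hv hsol hwc hw (smoothTorus_fourier_im k) ht hs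
    have e1 := (innerSL ℂ (toL2 (smoothC _ (smoothTorus_fourier_re k)))).intervalIntegral_comp_comm
      hFi
    have e2 := (innerSL ℂ (toL2 (smoothC _ (smoothTorus_fourier_im k)))).intervalIntegral_comp_comm
      hFi
    simp only [innerSL_apply_apply] at e1 e2
    rw [e1] at h1
    rw [e2] at h2
    rw [map_add, coef_apply, coef_apply, coef_apply, expL2_eq_re_add_im]
    simp only [inner_add_left, inner_smul_left]
    linear_combination ((2 * Real.pi : ℝ) : ℂ)⁻¹ * (h1 + conj Complex.I * h2)
  have hd : HasDerivAt (fun s => v t + ∫ r in t..s, F r) (F t) t :=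
    (intervalIntegral.integral_hasDerivAt_right IntervalIntegrable.refl
      (hFc.stronglyMeasurableAtFilter isOpen_Ioo t ht)
      (hFc.continuousAt (isOpen_Ioo.mem_nhds ht))).const_add _
  refine hd.congr_of_eventuallyEq ?_
  filter_upwards [isOpen_Ioo.mem_nhds ht] with s hs using key s hs

end Trajectory

/-! ### Integration in time. -/

lemma eLpNorm_Dpow_half {u : L2} (hu : Summable fun k : ℤ => |(k : ℝ)| * ‖coef k u‖ ^ 2) :
    (eLpNorm (Dpow (1 / 2) u) 2 volume) ^ 2 = ENNReal.ofReal (halfSq u) := by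
  have hsq : ∀ k : ℤ, ‖((|(k : ℝ)| ^ (1 / 2 : ℝ) : ℝ) : ℂ) * coef k u‖ ^ 2
      = |(k : ℝ)| * ‖coef k u‖ ^ 2 := fun k => by
    rw [norm_mul, mul_pow, Complex.norm_real, Real.norm_of_nonneg (by positivity),
      ← Real.sqrt_eq_rpow, Real.sq_sqrt (abs_nonneg _)]
  obtain ⟨z, hz⟩ := exists_coef_eq (c := fun k => ((|(k : ℝ)| ^ (1 / 2 : ℝ) : ℝ) : ℂ) * coef k u)
    (by simpa only [hsq] using hu)
  have h1 : Dpow (1 / 2) u = z := fourierMul_eq fun k => by rw [hz, coef_eq_fourierCoeff]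
  rw [h1, ← Lp.enorm_def, ← ofReal_norm, ← ENNReal.ofReal_pow (norm_nonneg _), norm_sq_eq_tsum]
  simp only [hz, hsq]
  rfl

section Integration

variable {T : ℝ} {v F : ℝ → L2}

/-- The derivative is known only on the open interval; continuity of `v` in `L²` carries the
monotonicity to `t = 0`. -/
lemma norm_le_norm_zero (hvc : ContinuousOn v (Icc 0 T))
    (hd : ∀ t ∈ Ioo 0 T, HasDerivAt v (F t) t)
    (hneg : ∀ t ∈ Ioo 0 T, (inner ℂ (v t) (F t)).re ≤ 0) {t : ℝ} (ht : t ∈ Icc 0 T) :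
    ‖v t‖ ≤ ‖v 0‖ := by
  have hder : ∀ t ∈ Ioo 0 T, HasDerivAt (fun s => ‖v s‖ ^ 2) (2 * (inner ℂ (v t) (F t)).re) t := by
    intro t ht
    have h1 := (hd t ht).inner ℂ (hd t ht)
    have h2 := Complex.reCLM.hasFDerivAt.comp_hasDerivAt t h1
    convert! h2 using 1
    · ext s
      exact (inner_self_eq_norm_sq (𝕜 := ℂ) (v s)).symm
    · rw [← inner_conj_symm (F t) (v t)]
      simp only [Complex.reCLM_apply, Complex.add_re, Complex.conj_re]
      ring
  have hanti : AntitoneOn (fun s => ‖v s‖ ^ 2) (Icc 0 T) := by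
    refine antitoneOn_of_deriv_nonpos (convex_Icc 0 T) (hvc.norm.pow 2) ?_ ?_
    · rw [interior_Icc]
      exact fun t ht => (hder t ht).differentiableAt.differentiableWithinAt
    · rw [interior_Icc]
      intro t ht
      rw [(hder t ht).deriv]
      linarith [hneg t ht]
  have h := hanti ⟨le_rfl, ht.1.trans ht.2⟩ ht ht.1
  exact abs_le_of_sq_le_sq' h (norm_nonneg _) |>.2

/-- Integration of a differential inequality for the functional `Re (B v + M v, v)`. -/
lemma integral_le_of_re_inner_le {B : C(Torus, ℂ)} (hB : star B = B) {M R κ Q : ℝ} (hM : 0 ≤ M)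
    (hQ : 0 ≤ Q) (hd : ∀ t ∈ Ioo 0 T, HasDerivAt v (F t) t) (hF : ContinuousOn F (Ioo 0 T))
    (hR : ∀ t ∈ Ioo 0 T, ‖v t‖ ≤ R) {x : ℝ → ℝ} (hx : ContinuousOn x (Ioo 0 T))
    (hle : ∀ t ∈ Ioo 0 T, (inner ℂ (mulL2 B (v t)) (F t)).re + M * (inner ℂ (v t) (F t)).re
      ≤ -(κ / 2 * x t) + Q) {s t : ℝ} (hs : s ∈ Ioo 0 T) (ht : t ∈ Ioo 0 T) (hst : s ≤ t) :
    κ * ∫ r in s..t, x r ≤ 2 * (‖mulL2 B‖ + M) * R ^ 2 + 2 * Q * T := by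
  have hsub : Icc s t ⊆ Ioo 0 T := fun r hr => ⟨hs.1.trans_le hr.1, hr.2.trans_lt ht.2⟩
  have hvc : ContinuousOn v (Ioo 0 T) := fun r hr => (hd r hr).continuousAt.continuousWithinAt
  -- As `B` is real, multiplication by it is symmetric, so the derivative of `E` is twice the
  -- quantity bounded in `hle`. The final bound is `|E|` at the two endpoints plus the integral of
  -- `2Q`.
  set E : ℝ → ℝ := fun r => (inner ℂ (mulL2 B (v r)) (v r)).re + M * (inner ℂ (v r) (v r)).re with hE
  set E' : ℝ → ℝ := fun r => 2 * ((inner ℂ (mulL2 B (v r)) (F r)).re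
    + M * (inner ℂ (v r) (F r)).re) with hE'
  have hBv : ∀ r ∈ Ioo 0 T, HasDerivAt (fun r => mulL2 B (v r)) (mulL2 B (F r)) r := fun r hr =>
    ((mulL2 B).restrictScalars ℝ).hasFDerivAt.comp_hasDerivAt r (hd r hr)
  have hder : ∀ r ∈ Ioo 0 T, HasDerivAt E (E' r) r := by
    intro r hr
    have h1 := Complex.reCLM.hasFDerivAt.comp_hasDerivAt r ((hBv r hr).inner ℂ (hd r hr))
    have h2 := Complex.reCLM.hasFDerivAt.comp_hasDerivAt r ((hd r hr).inner ℂ (hd r hr))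
    convert! h1.add (h2.const_mul M) using 1
    rw [inner_mulL2_left B (F r), hB, ← inner_conj_symm (F r) (v r),
      ← inner_conj_symm (F r) (mulL2 B (v r))]
    simp only [hE', Complex.reCLM_apply, Complex.add_re, Complex.conj_re]
    ring
  have hE'c : ContinuousOn E' (Ioo 0 T) := by
    have c1 : ContinuousOn (fun r => inner ℂ (mulL2 B (v r)) (F r)) (Ioo 0 T) :=
      ((mulL2 B).continuous.comp_continuousOn hvc).inner hF
    have c2 : ContinuousOn (fun r => inner ℂ (v r) (F r)) (Ioo 0 T) := hvc.inner hF
    exact continuousOn_const.mul ((Complex.continuous_re.comp_continuousOn c1).add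
      (continuousOn_const.mul (Complex.continuous_re.comp_continuousOn c2)))
  have hE'i : IntervalIntegrable E' volume s t := by
    refine ContinuousOn.intervalIntegrable (hE'c.mono ?_)
    rwa [uIcc_of_le hst]
  have hxi : IntervalIntegrable x volume s t := by
    refine ContinuousOn.intervalIntegrable (hx.mono ?_)
    rwa [uIcc_of_le hst]
  have h1 : ∫ r in s..t, E' r = E t - E s :=
    intervalIntegral.integral_eq_sub_of_hasDerivAt (fun r hr => hder r (hsub (by
      rwa [uIcc_of_le hst] at hr))) hE'i
  have h2 : ∫ r in s..t, E' r ≤ ∫ r in s..t, (2 * Q - κ * x r) :=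
    intervalIntegral.integral_mono_on hst hE'i
      (intervalIntegrable_const.sub (hxi.const_mul κ)) fun r hr => by
        have := hle r (hsub hr)
        simp only [hE']
        linarith
  rw [h1, intervalIntegral.integral_sub intervalIntegrable_const (hxi.const_mul κ),
    intervalIntegral.integral_const, intervalIntegral.integral_const_mul, smul_eq_mul] at h2
  have hEb : ∀ r ∈ Ioo 0 T, |E r| ≤ (‖mulL2 B‖ + M) * R ^ 2 := fun r hr => by
    have hn := hR r hr
    have a1 : |(inner ℂ (mulL2 B (v r)) (v r)).re| ≤ ‖mulL2 B‖ * R ^ 2 := by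
      refine (Complex.abs_re_le_norm _).trans ((norm_inner_le_norm _ _).trans ?_)
      have hR0 : 0 ≤ R := (norm_nonneg _).trans hn
      have hBv : ‖mulL2 B (v r)‖ ≤ ‖mulL2 B‖ * R := ((mulL2 B).le_opNorm _).trans (by gcongr)
      rw [sq, ← mul_assoc]
      exact mul_le_mul hBv hn (norm_nonneg _) (by positivity)
    have a2 : |(inner ℂ (v r) (v r)).re| ≤ R ^ 2 := by
      refine (Complex.abs_re_le_norm _).trans ((norm_inner_le_norm _ _).trans ?_)
      rw [← sq]
      gcongr
    calc |E r| ≤ |(inner ℂ (mulL2 B (v r)) (v r)).re| + |M * (inner ℂ (v r) (v r)).re| :=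
          abs_add_le _ _
      _ ≤ ‖mulL2 B‖ * R ^ 2 + M * R ^ 2 := by
        rw [abs_mul, abs_of_nonneg hM]
        gcongr
      _ = _ := by ring
  have b1 := (abs_le.1 (hEb s hs)).2
  have b2 := (abs_le.1 (hEb t ht)).1
  have b3 : (t - s) * (2 * Q) ≤ T * (2 * Q) := by
    have : t - s ≤ T := by linarith [hs.1, ht.2]
    gcongr
  linarith

/-- Exhaustion by compact subintervals: `H²` control is available neither at `0` nor uniformly near
it. -/
lemma lintegral_Ioo_le {x : ℝ → ℝ} (hT : 0 < T) (hx : ContinuousOn x (Ioo 0 T))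
    (hx0 : ∀ t ∈ Ioo 0 T, 0 ≤ x t) {K : ℝ}
    (h : ∀ s ∈ Ioo 0 T, ∀ t ∈ Ioo 0 T, s ≤ t → ∫ r in s..t, x r ≤ K) :
    ∫⁻ t in Ioo 0 T, ENNReal.ofReal (x t) ≤ ENNReal.ofReal K := by
  -- The shift by `3` keeps `T/(n+3) ≤ T/3`, so the endpoints are interior and in the right order
  -- from `n = 0` on.
  have hs : Tendsto (fun n : ℕ => T / (n + 3)) atTop (𝓝 0) := by
    have := tendsto_const_div_atTop_nhds_zero_nat T
    exact (this.comp (tendsto_add_atTop_nat 3)).congr fun n => by simp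
  have ht : Tendsto (fun n : ℕ => T - T / (n + 3)) atTop (𝓝 T) := by
    simpa using hs.const_sub T
  have hcov := aecover_Ioo_of_Ioc (μ := (volume : Measure ℝ)) hs ht
  have hm : AEMeasurable (fun t => ENNReal.ofReal (x t)) (volume.restrict (Ioo 0 T)) :=
    (hx.aemeasurable measurableSet_Ioo).ennreal_ofReal
  refine le_of_tendsto (hcov.lintegral_tendsto_of_countably_generated hm)
    (Eventually.of_forall fun n => ?_)
  have hn : (0 : ℝ) ≤ n := Nat.cast_nonneg n
  have hpos : 0 < T / (n + 3) := by positivity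
  have hle : T / (n + 3) ≤ T / 3 := by gcongr; linarith
  have hs' : T / (n + 3) ∈ Ioo 0 T := ⟨hpos, by linarith⟩
  have ht' : T - T / (n + 3) ∈ Ioo 0 T := ⟨by linarith, by linarith⟩
  have hst : T / (n + 3) ≤ T - T / (n + 3) := by linarith
  have hsub : Ioc (T / (n + 3)) (T - T / (n + 3)) ⊆ Ioo 0 T := fun r hr =>
    ⟨hpos.trans hr.1, hr.2.trans_lt ht'.2⟩
  have hint : IntegrableOn x (Ioc (T / (n + 3)) (T - T / (n + 3))) :=
    (intervalIntegrable_iff_integrableOn_Ioc_of_le hst).1 (ContinuousOn.intervalIntegrable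
      (hx.mono (ordConnected_Ioo.uIcc_subset hs' ht')))
  rw [Measure.restrict_restrict_of_subset hsub, ← ofReal_integral_eq_lintegral_ofReal hint]
  · refine ENNReal.ofReal_le_ofReal ?_
    have := h _ hs' _ ht' hst
    rwa [intervalIntegral.integral_of_le hst] at this
  · rw [EventuallyLE, ae_restrict_iff' measurableSet_Ioc]
    exact Eventually.of_forall fun r hr => hx0 r (hsub hr)

end Integration

end BenjaminOno

end

/-! ### Conclusion. -/

open BenjaminOno in
theorem proposition2p7 (a : BenjaminOno.Torus → ℝ) (ha_smooth : BenjaminOno.SmoothTorus a)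
    (ha_nonneg : ∀ x, 0 ≤ a x) (ha_int : ∫ x, a x = 1) (T : ℝ) (hT : 0 < T) :
    ∃ C : ℝ, 0 < C ∧
      ∀ (ε α R : ℝ), 0 < ε → 0 < R →
        ∀ v₀ : BenjaminOno.L2, BenjaminOno.MemH00 v₀ → ‖v₀‖ ≤ R →
          ∀ v : ℝ → BenjaminOno.L2, BenjaminOno.Regular T v →
            BenjaminOno.SolvesDampedBO a ε α T v → v 0 = v₀ →
              ∫⁻ t in Ioo 0 T, (eLpNorm (BenjaminOno.Dpow (1 / 2) (v t)) 2 volume) ^ 2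
                ≤ ENNReal.ofReal (C * (R ^ 2 + α ^ 4 * R ^ 6)) := by
  obtain ⟨a1, ha1, hd1⟩ := ha_smooth.exists_deriv
  obtain ⟨b, hb, hb1⟩ := exists_antideriv ha_smooth ha_int
  have hA1 := hasTorusDeriv_smoothC ha_smooth ha1 hd1
  have hab : SmoothTorus fun x => a x * b x := ContDiff.mul ha_smooth hb
  have hABd : FastDecay (smoothC a ha_smooth * smoothC b hb) := by
    have h : smoothC a ha_smooth * smoothC b hb = smoothC _ hab := by
      ext x
      simp
    rw [h]
    exact fastDecay_smoothC hab
  have hκ : 0 < (2 * Real.pi)⁻¹ := inv_pos.2 Real.two_pi_pos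
  rw [← Complex.ofReal_inv] at hb1
  obtain ⟨M, hM, hmain⟩ := exists_smoothing_le (star_smoothC ha_smooth) hA1
    (fastDecay_smoothC ha_smooth) (star_smoothC hb) (fastDecay_smoothC hb) hABd hκ hb1
  set N := ‖mulL2 (smoothC b hb)‖
  -- The factor `2π` is `κ⁻¹`; the bracket bounds the endpoint terms and the time integral of the
  -- remainder; the summand `1` only ensures positivity.
  refine ⟨2 * Real.pi * (2 * (N + M) + 2 * M * T) + 1, by positivity,
    fun ε α R hε hR v₀ _ hv₀R v hv hsol hv0 => ?_⟩
  obtain ⟨w, hwc, hw⟩ := exists_continuousOn_of_continuousInSobolev hv.continuousH2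
  have hwo : ContinuousOn w (Ioo 0 T) := hwc.mono Ioo_subset_Ioc_self
  set F : ℝ → L2 := fun t => trajDeriv (smoothC a ha_smooth) (smoothC a1 ha1) ε α (w t) with hF
  have hFc : ContinuousOn F (Ioo 0 T) := (continuous_timeDeriv _ _ _ _).comp_continuousOn hwo
  have hd : ∀ t ∈ Ioo 0 T, HasDerivAt v (F t) t := fun t ht =>
    hasDerivAt_trajectory ha_smooth hA1 hv hsol hwc hw ht
  have hH : ∀ t ∈ Ioo 0 T, IsH2 (bessel (w t)) (besselDeriv (w t)) (besselDerivTwo (w t)) :=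
    fun t ht => isH2_bessel (hv.memH00 t (Ioo_subset_Icc_self ht)) (hw t (Ioo_subset_Ioc_self ht))
  have hvV : ∀ t ∈ Ioo 0 T, toL2 (bessel (w t)) = v t := fun t ht =>
    toL2_bessel (hw t (Ioo_subset_Ioc_self ht))
  have hvR : ∀ t ∈ Icc 0 T, ‖v t‖ ≤ R := fun t ht => by
    refine (norm_le_norm_zero hv.continuousOn hd (fun s hs => ?_) ht).trans (by rwa [hv0])
    have h := (hH s hs).re_inner_timeDeriv (star_smoothC ha_smooth) hA1 ε α
    rw [hvV s hs] at h
    have h1 := halfSq_nonneg (opGL2 (smoothC a ha_smooth) (v s))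
    have h2 : 0 ≤ ε * ‖toL2 (besselDeriv (w s))‖ ^ 2 := by positivity
    change (inner ℂ (v s) (timeDeriv _ _ _ _ _ _ _)).re ≤ 0
    rw [h]
    linarith
  -- Continuity comes from `‖D^{1/2}v‖² = Re (v, Hv_x)`, both factors being continuous in `L²`.
  have hxc : ContinuousOn (fun t => halfSq (v t)) (Ioo 0 T) := by
    have h : ContinuousOn (fun t => (inner ℂ (v t) (hilbL2 (toL2 (besselDeriv (w t))))).re)
        (Ioo 0 T) := by
      refine Complex.continuous_re.comp_continuousOn (ContinuousOn.inner
        (hv.continuousOn.mono Ioo_subset_Icc_self) ?_)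
      exact (Continuous.comp_continuousOn (g := fun u : L2 => hilbL2 (toL2 (besselDeriv u)))
        (by fun_prop) hwo)
    refine h.congr fun t ht => ?_
    have h1 := inner_eq_halfSq (hH t ht).deriv.coef_hilbL2
    rw [hvV t ht] at h1
    exact ((congrArg Complex.re h1).trans (Complex.ofReal_re _)).symm
  have hQ : 0 ≤ R ^ 2 + α ^ 4 * R ^ 6 := by positivity
  have hint := fun (s : ℝ) hs (t : ℝ) ht hst => integral_le_of_re_inner_le (star_smoothC hb) hM
    (mul_nonneg hM hQ) hd hFc (fun r hr => hvR r (Ioo_subset_Icc_self hr)) hxc (fun r hr => by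
      have h := hmain _ _ _ (hH r hr) ε α R hε hR
        (by rw [hvV r hr]; exact hvR r (Ioo_subset_Icc_self hr))
      rw [hvV r hr] at h
      exact h) (s := s) (t := t) hs ht hst
  have hcongr : ∫⁻ t in Ioo 0 T, (eLpNorm (Dpow (1 / 2) (v t)) 2 volume) ^ 2
      = ∫⁻ t in Ioo 0 T, ENNReal.ofReal (halfSq (v t)) := by
    refine setLIntegral_congr_fun measurableSet_Ioo fun t ht => ?_
    have h := (hH t ht).summable_half
    rw [hvV t ht] at h
    exact eLpNorm_Dpow_half h
  rw [hcongr]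
  refine lintegral_Ioo_le hT hxc (fun t _ => halfSq_nonneg _) fun s hs t ht hst => ?_
  have h := hint s hs t ht hst
  rw [inv_mul_le_iff₀ Real.two_pi_pos] at h
  refine h.trans ?_
  have h1 : R ^ 2 ≤ R ^ 2 + α ^ 4 * R ^ 6 := le_add_of_nonneg_right (by positivity)
  calc 2 * Real.pi * (2 * (N + M) * R ^ 2 + 2 * (M * (R ^ 2 + α ^ 4 * R ^ 6)) * T)
      ≤ 2 * Real.pi * (2 * (N + M) * (R ^ 2 + α ^ 4 * R ^ 6)
        + 2 * (M * (R ^ 2 + α ^ 4 * R ^ 6)) * T) := by gcongr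
    _ ≤ _ := by linarith
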